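/- **Theorem (Consistency).** Let $K_1,K_2,R\ge 0$ be fixed integers and $K=K_1+K_2$. For all $N,T$ let $X_1,\dots,X_K$ and $e$ be random $N\times T$ matrices, $\lambda^0$ a random $N\times R$ matrix and $f^0$ a random $T\times R$ matrix (all depending on $(N,T)$), let $\beta^0\in\mathbb R^K$ be fixed, and let $$Y=\beta^0\cdot X+\lambda^0 f^{0\prime}+e,\qquad \beta\cdot X:=\sum_{k=1}^K\beta_kX_k .$$ The regressors $X_1,\dots,X_{K_1}$ are called low-rank, $X_{K_1+1},\dots,X_K$ high-rank. Write $X_{it}=(X_{1,it},\dots,X_{K,it})'$, $\|\cdot\|_F$ for the Frobenius norm, $\|\cdot\|$ for the Euclidean norm of a vector and the spectral norm of a matrix, $\mu_r(S)$ for the $r$-th largest eigenvalue (with multiplicity) of a symmetric matrix $S$, and $M_A=\mathbb I-A(A'A)^\dagger A'$ with $\dagger$ the Moore–Penrose pseudoinverse. For symmetric matrices $C>D$ means that $C-D$ is positive definite. Probability limits are constants, limits are taken as $N,T\to\infty$ jointly, and "wpa1" means with probability approaching one in this limit. Assume: 1. $\operatorname{plim}\lambda^{0\prime}\lambda^0/N>0$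 and $\operatorname{plim} f^{0\prime}f^0/T>0$. 2. $\operatorname{plim}\,(NT)^{-1}\operatorname{Tr}(X_ke')=0$ for all $k=1,\dots,K$. 3. $\operatorname{plim}\,\|e\|/\sqrt{NT}=0$. 4. (i) $\operatorname{plim}\,(NT)^{-1}\sum_{i=1}^N\sum_{t=1}^TX_{it}X_{it}'>0$. (ii)(a) There is a constant $b>0$ such that, wpa1, $$\min_{\alpha\in\mathbb R^{K_2},\,\|\alpha\|=1}\ \sum_{r=2R+K_1+1}^{N}\mu_r\!\left[\frac{(\alpha\cdot X_{\rm high})(\alpha\cdot X_{\rm high})'}{NT}\right]\ \ge\ b,\qquad \alpha\cdot X_{\rm high}:=\sum_{m=1}^{K_2}\alpha_mX_{K_1+m}$$ (no condition if $K_2=0$). (ii)(b) Wpa1, $\operatorname{rank}(X_l)=1$ and $X_l=w_lv_l'$ for $l=1,\dots,K_1$, with $N$-vectors $w_l$ and $T$-vectors $v_l$; and, with $w=(w_1,\dots,w_{K_1})$ and $v=(v_1,\dots,v_{K_1})$, there is a constant $B>0$ such that, wpa1, $N^{-1}\lambda^{0\prime}M_w\lambda^0>B\,\mathbb I_R$ and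 $T^{-1}f^{0\prime}M_vf^0>B\,\mathbb I_R$. Let $\mathbb B\subset\mathbb R^K$ be compact with $\beta^0\in\mathbb B$, and let $$\widehat\beta\in\operatorname*{argmin}_{\beta\in\mathbb B}L_{NT}(\beta),\qquad L_{NT}(\beta)=\min_{\lambda\in\mathbb R^{N\times R},\,f\in\mathbb R^{T\times R}}\frac1{NT}\left\|Y-\beta\cdot X-\lambda f'\right\|_F^2$$ be the least squares estimator (almost surely, for all $N,T$); $L_{NT}(\beta)$ is the same as $(NT)^{-1}$ times the sum of the $T-R$ smallest eigenvalues of $(Y-\beta\cdot X)'(Y-\beta\cdot X)$. Then $$\widehat\beta\ \longrightarrow_p\ \beta^0\qquad\text{as } N,T\to\infty .$$ -/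

import Mathlib

open MeasureTheory Filter Topology Matrix

open scoped Matrix.Norms.L2Operator

noncomputable section

namespace InteractiveFE

/-! ### Matrix notions -/

theorem isHermitian_transpose_mul_self {m n : Type*} [Fintype m] (A : Matrix m n ℝ) :
    (Aᵀ * A).IsHermitian := by
  have h := Matrix.isHermitian_conjTranspose_mul_self A
  rwa [Matrix.conjTranspose_eq_transpose_of_trivial] at h

theorem isHermitian_smul_self_mul_transpose {m n : Type*} [Fintype n] (c : ℝ)
    (A : Matrix m n ℝ) : (c • (A * Aᵀ)).IsHermitian := by
  unfold Matrix.IsHermitian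
  simp [Matrix.conjTranspose_eq_transpose_of_trivial]

/-- Moore-Penrose pseudoinverse of a real symmetric matrix: in an orthonormal eigenbasis the
nonzero eigenvalues are inverted and the zero eigenvalues are kept (`0⁻¹ = 0` in `ℝ`).
The four Penrose equations are proved in `symmPinv_penrose`. -/
def symmPinv {n : Type*} [Fintype n] [DecidableEq n] {S : Matrix n n ℝ} (hS : S.IsHermitian) :
    Matrix n n ℝ :=
  (hS.eigenvectorUnitary : Matrix n n ℝ) * Matrix.diagonal (fun i => (hS.eigenvalues i)⁻¹) *
    (hS.eigenvectorUnitary : Matrix n n ℝ)ᵀ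

theorem symmPinv_penrose {n : Type*} [Fintype n] [DecidableEq n] {S : Matrix n n ℝ}
    (hS : S.IsHermitian) :
    S * symmPinv hS * S = S ∧ symmPinv hS * S * symmPinv hS = symmPinv hS ∧
      (S * symmPinv hS)ᵀ = S * symmPinv hS ∧ (symmPinv hS * S)ᵀ = symmPinv hS * S := by
  obtain ⟨U, hU⟩ : ∃ U : Matrix n n ℝ, U = (hS.eigenvectorUnitary : Matrix n n ℝ) := ⟨_, rfl⟩
  have hUU : Uᵀ * U = 1 := by
    have h := Matrix.mem_unitaryGroup_iff'.1 hS.eigenvectorUnitary.2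
    rw [← hU, Matrix.star_eq_conjTranspose, Matrix.conjTranspose_eq_transpose_of_trivial] at h
    exact h
  have hS' : S = U * Matrix.diagonal hS.eigenvalues * Uᵀ := by
    have h := hS.spectral_theorem
    rw [Unitary.conjStarAlgAut_apply, ← hU, Matrix.star_eq_conjTranspose,
      Matrix.conjTranspose_eq_transpose_of_trivial] at h
    simpa using h
  have hP : symmPinv hS = U * Matrix.diagonal (fun i => (hS.eigenvalues i)⁻¹) * Uᵀ := by
    rw [symmPinv, hU]
  have key : ∀ d d' : n → ℝ, (U * Matrix.diagonal d * Uᵀ) * (U * Matrix.diagonal d' * Uᵀ) =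
      U * Matrix.diagonal (fun i => d i * d' i) * Uᵀ := by
    intro d d'
    calc (U * Matrix.diagonal d * Uᵀ) * (U * Matrix.diagonal d' * Uᵀ)
        = U * Matrix.diagonal d * (Uᵀ * U) * Matrix.diagonal d' * Uᵀ := by
          simp only [Matrix.mul_assoc]
      _ = _ := by rw [hUU, Matrix.mul_one, Matrix.mul_assoc U, Matrix.diagonal_mul_diagonal]
  have tr : ∀ d : n → ℝ, (U * Matrix.diagonal d * Uᵀ)ᵀ = U * Matrix.diagonal d * Uᵀ := by
    intro d
    simp [Matrix.transpose_mul, Matrix.mul_assoc]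
  rw [hP]
  generalize hS.eigenvalues = d at hS'
  subst hS'
  refine ⟨?_, ?_, ?_, ?_⟩
  · rw [key, key]
    congr 3
    funext i
    exact mul_inv_mul_cancel (d i)
  · rw [key, key]
    congr 3
    funext i
    by_cases h : d i = 0 <;> simp [h]
  · rw [key, tr]
  · rw [key, tr]

/-- The projector `M_A = 𝕀 - A (A'A)† A'`. -/
def annihilator {m n : Type*} [Fintype m] [DecidableEq m] [Fintype n] [DecidableEq n]
    (A : Matrix m n ℝ) : Matrix m m ℝ :=
  1 - A * symmPinv (isHermitian_transpose_mul_self A) * Aᵀ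

/-- `∑_{r = k+1}^N μ_r(S)` for a real symmetric `N × N` matrix `S`, where
`μ_1(S) ≥ ⋯ ≥ μ_N(S)` are its eigenvalues with multiplicity
(`Matrix.IsHermitian.eigenvalues₀` lists them in decreasing order, starting from index `0`). -/
def eigTailSum {n : Type*} [Fintype n] [DecidableEq n] {S : Matrix n n ℝ} (hS : S.IsHermitian)
    (k : ℕ) : ℝ :=
  ∑ r ∈ Finset.univ.filter (fun r : Fin (Fintype.card n) => k ≤ (r : ℕ)), hS.eigenvalues₀ r

/-- The squared Frobenius norm. -/
def frobSq {m n : Type*} [Fintype m] [Fintype n] (A : Matrix m n ℝ) : ℝ :=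
  (A * Aᵀ).trace

/-! ### Probability limits as `N, T → ∞` -/

/-- An event holds "with probability approaching one" as `N, T → ∞`: the probability of its
complement tends to zero. -/
def WPA1 {Ω : Type*} [MeasurableSpace Ω] (μ : Measure Ω) (P : ℕ → ℕ → Ω → Prop) : Prop :=
  Tendsto (fun p : ℕ × ℕ => μ {ω | ¬ P p.1 p.2 ω}) atTop (𝓝 0)

/-- `A_{NT} →_p a` as `N, T → ∞` jointly, for a constant `a`. -/
def Plim {Ω : Type*} [MeasurableSpace Ω] (μ : Measure Ω) {E : Type*} [EDist E]
    (A : ℕ → ℕ → Ω → E) (a : E) : Prop :=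
  TendstoInMeasure μ (fun (p : ℕ × ℕ) ω => A p.1 p.2 ω) atTop (fun _ => a)

/-- `plim A_{NT} > 0`: the square matrices `A_{NT}` of fixed size converge in probability, entry
by entry, to a constant positive definite matrix. -/
def PlimPosDef {Ω : Type*} [MeasurableSpace Ω] (μ : Measure Ω) {k : Type*} [Fintype k]
    (A : ℕ → ℕ → Ω → Matrix k k ℝ) : Prop :=
  ∃ S : Matrix k k ℝ, S.PosDef ∧ ∀ i j, Plim μ (fun N T ω => A N T ω i j) (S i j)

/-! ### The panel regression model with interactive fixed effects -/

/-- The unobserved and observed ingredients of the model, for every panel size `(N, T)`.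
There are `K₁` low-rank regressors, indexed by `Sum.inl l`, `K₂` high-rank regressors, indexed by
`Sum.inr m`, and `R` factors. -/
structure Panel (Ω : Type*) (K₁ K₂ R : ℕ) where
  /-- the true regression coefficients `β⁰ ∈ ℝ^K`, `K = K₁ + K₂` -/
  beta0 : EuclideanSpace ℝ (Fin K₁ ⊕ Fin K₂)
  /-- the regressors, `N × T` matrices `X_k` -/
  X : Fin K₁ ⊕ Fin K₂ → (N T : ℕ) → Ω → Matrix (Fin N) (Fin T) ℝ
  /-- the true factor loadings, an `N × R` matrix `λ⁰` -/
  lam0 : (N T : ℕ) → Ω → Matrix (Fin N) (Fin R) ℝ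
  /-- the true factors, a `T × R` matrix `f⁰` -/
  f0 : (N T : ℕ) → Ω → Matrix (Fin T) (Fin R) ℝ
  /-- the errors, an `N × T` matrix `e` -/
  e : (N T : ℕ) → Ω → Matrix (Fin N) (Fin T) ℝ

namespace Panel

variable {Ω : Type*} {K₁ K₂ R : ℕ} (P : Panel Ω K₁ K₂ R)

/-- `β · X = ∑_k β_k X_k`. -/
def dotX (β : EuclideanSpace ℝ (Fin K₁ ⊕ Fin K₂)) (N T : ℕ) (ω : Ω) :
    Matrix (Fin N) (Fin T) ℝ :=
  ∑ k, β k • P.X k N T ω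

/-- `α · X_high = ∑_m α_m X_m`, the sum over the high-rank regressors. -/
def dotXHigh (α : EuclideanSpace ℝ (Fin K₂)) (N T : ℕ) (ω : Ω) :
    Matrix (Fin N) (Fin T) ℝ :=
  ∑ m, α m • P.X (Sum.inr m) N T ω

/-- The outcomes `Y = β⁰ · X + λ⁰ f⁰' + e`. -/
def Y (N T : ℕ) (ω : Ω) : Matrix (Fin N) (Fin T) ℝ :=
  P.dotX P.beta0 N T ω + P.lam0 N T ω * (P.f0 N T ω)ᵀ + P.e N T ω

/-- The objective function `𝓛_{NT}(β, λ, f) = (NT)⁻¹ ‖Y - β · X - λ f'‖_F²`. -/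
def objective (N T : ℕ) (ω : Ω) (β : EuclideanSpace ℝ (Fin K₁ ⊕ Fin K₂))
    (lam : Matrix (Fin N) (Fin R) ℝ) (f : Matrix (Fin T) (Fin R) ℝ) : ℝ :=
  ((N : ℝ) * T)⁻¹ * frobSq (P.Y N T ω - P.dotX β N T ω - lam * fᵀ)

/-- The profile objective function `L_{NT}(β) = min_{λ, f} 𝓛_{NT}(β, λ, f)`, the minimum being
over all `N × R` matrices `λ` and all `T × R` matrices `f`. -/
def profile (N T : ℕ) (ω : Ω) (β : EuclideanSpace ℝ (Fin K₁ ⊕ Fin K₂)) : ℝ :=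
  ⨅ q : Matrix (Fin N) (Fin R) ℝ × Matrix (Fin T) (Fin R) ℝ, P.objective N T ω β q.1 q.2

/-- `b` is a value of the LS estimator: `b ∈ argmin_{β ∈ 𝔹} L_{NT}(β)`. -/
def IsLSEstimate (𝔹 : Set (EuclideanSpace ℝ (Fin K₁ ⊕ Fin K₂))) (N T : ℕ) (ω : Ω)
    (b : EuclideanSpace ℝ (Fin K₁ ⊕ Fin K₂)) : Prop :=
  b ∈ 𝔹 ∧ ∀ β ∈ 𝔹, P.profile N T ω b ≤ P.profile N T ω β

variable [MeasurableSpace Ω] (μ : Measure Ω)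

/-- Strong loadings and factors: `plim λ⁰'λ⁰ / N > 0` and `plim f⁰'f⁰ / T > 0`. -/
def StrongFactors : Prop :=
  PlimPosDef μ (fun N T ω => (N : ℝ)⁻¹ • ((P.lam0 N T ω)ᵀ * P.lam0 N T ω)) ∧
    PlimPosDef μ (fun N T ω => (T : ℝ)⁻¹ • ((P.f0 N T ω)ᵀ * P.f0 N T ω))

/-- Weak exogeneity: `plim (NT)⁻¹ Tr(X_k e') = 0` for every regressor. -/
def WeakExogeneity : Prop :=
  ∀ k, Plim μ (fun N T ω => ((N : ℝ) * T)⁻¹ * (P.X k N T ω * (P.e N T ω)ᵀ).trace) 0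

/-- `plim ‖e‖ / √(NT) = 0`, where `‖e‖` is the spectral norm (the `ℓ²` operator norm). -/
def SmallErrorNorm : Prop :=
  Plim μ (fun N T ω => ‖P.e N T ω‖ / Real.sqrt ((N : ℝ) * T)) 0

/-- Non-collinearity of the regressors: `plim (NT)⁻¹ ∑_i ∑_t X_it X_it' > 0`. -/
def NonCollinear : Prop :=
  PlimPosDef μ (fun N T ω =>
    Matrix.of fun k l => ((N : ℝ) * T)⁻¹ * ∑ i, ∑ t, P.X k N T ω i t * P.X l N T ω i t)

/-- Condition on the high-rank regressors: for some `b > 0`, wpa1,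
`min_{‖α‖ = 1} ∑_{r = 2R+K₁+1}^N μ_r[(α·X_high)(α·X_high)' / (NT)] ≥ b`
(no condition if there are no high-rank regressors). -/
def HighRankCondition : Prop :=
  ∃ b : ℝ, 0 < b ∧ WPA1 μ (fun N T ω =>
    ∀ α : EuclideanSpace ℝ (Fin K₂), ‖α‖ = 1 →
      b ≤ eigTailSum (isHermitian_smul_self_mul_transpose ((N : ℝ) * T)⁻¹ (P.dotXHigh α N T ω))
        (2 * R + K₁))

/-- Condition on the low-rank regressors: they are of rank one, `X_l = w_l v_l'`, and for the
`N × K₁` matrix `w = (w_1, …, w_{K₁})`, the `T × K₁` matrix `v = (v_1, …, v_{K₁})` and some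
constant `B > 0` one has `N⁻¹ λ⁰' M_w λ⁰ > B 𝕀_R` and `T⁻¹ f⁰' M_v f⁰ > B 𝕀_R`, wpa1. -/
def LowRankCondition : Prop :=
  ∃ (w : (N T : ℕ) → Ω → Matrix (Fin N) (Fin K₁) ℝ)
    (v : (N T : ℕ) → Ω → Matrix (Fin T) (Fin K₁) ℝ) (B : ℝ), 0 < B ∧
    WPA1 μ (fun N T ω =>
      (∀ l : Fin K₁, (P.X (Sum.inl l) N T ω).rank = 1 ∧
        P.X (Sum.inl l) N T ω =
          Matrix.vecMulVec (fun i => w N T ω i l) (fun t => v N T ω t l)) ∧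
      ((N : ℝ)⁻¹ • ((P.lam0 N T ω)ᵀ * annihilator (w N T ω) * P.lam0 N T ω) -
        B • (1 : Matrix (Fin R) (Fin R) ℝ)).PosDef ∧
      ((T : ℝ)⁻¹ • ((P.f0 N T ω)ᵀ * annihilator (v N T ω) * P.f0 N T ω) -
        B • (1 : Matrix (Fin R) (Fin R) ℝ)).PosDef)

end Panel

end InteractiveFE

end

/-!
Put `d = β⁰ - β̂`, and divide `X_k` and `e` by `√(NT)`, `λ⁰` by `√N` and `f⁰` by `√T`. The true
loadings and factors are admissible in the minimization defining the profile objective, so some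
factor structure `l f'` satisfies `‖d·X + (λ⁰f⁰' - l f') + e‖_F² ≤ ‖e‖_F² + ε`
(`IsLSEstimate.exists_objective_lt`). Expanding the square, the cross term of `e` with `d·X` is negligible by exogeneity. The cross term
with `λ⁰f⁰' - l f'` is negligible because this matrix has rank at most `2R`: trace duality bounds it
by `√(2R) ‖e‖ ‖λ⁰f⁰' - l f'‖_F`, with the spectral norm of `e`. Hence `d·X + λ⁰f⁰' - l f'` tends to
zero in Frobenius norm (`frob_add_sq_le`), and it remains to see that this forces `d` to be small.

*High-rank part.* The low-rank regressors together with `λ⁰f⁰' - l f'` form a matrix of rank at most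
`2R + K₁`. By the Eckart-Young lower bound (`eigTailSum_le_frobSq_sub`) its distance from the
combination of the high-rank regressors is at least `√b` times the norm of the high-rank
coefficients, so these are small.

*Low-rank part.* What is left is that `C = l f'` is close to `A = D + λ⁰f⁰'` with `D = w Δ v'`,
`Δ` diagonal. The condition on `M_w` and `M_v` provides matrices `P` and `Q` of bounded norm with
`P λ⁰ = 𝕀`, `P w = 0`, `f⁰' Q = 𝕀`, `v' Q = 0` (`exists_leftInverse_of_posDef`). Then
`P A Q = 𝕀`, so `P C Q` is close to `𝕀`, hence invertible. Since `C` factors through `R` dimensions,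
it follows that `C = C Q (P C Q)⁻¹ P C`, which is close to `A Q · P A = λ⁰ f⁰'`. So `D` is close to
`A - C`, that is, small (`frob_le_of_frob_add_sub_le`).

Thus `d·X` is small, and non-collinearity makes `d` small. All these bounds are uniform in the panel
size (`exists_forall_norm_lt`), and their hypotheses hold on an intersection of finitely many events
of probability approaching one.
-/

noncomputable section

namespace InteractiveFE

/-! ### The Frobenius norm and the trace inner product -/

section Frobenius

variable {l m n κ : Type*} [Fintype l] [Fintype m] [Fintype n] [Fintype κ]

theorem trace_mul_transpose_eq_sum (A B : Matrix m n ℝ) :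
    (A * Bᵀ).trace = ∑ i, ∑ j, A i j * B i j := by
  simp [Matrix.trace, Matrix.mul_apply]

theorem frobSq_eq_sum (A : Matrix m n ℝ) : frobSq A = ∑ i, ∑ j, A i j ^ 2 := by
  simp [frobSq, trace_mul_transpose_eq_sum, sq]

theorem frobSq_nonneg (A : Matrix m n ℝ) : 0 ≤ frobSq A := by
  rw [frobSq_eq_sum]; positivity

/-- The Frobenius norm. It is a plain function rather than an instance, because the norm on
matrices in force here is the spectral norm. -/
def frob (A : Matrix m n ℝ) : ℝ := Real.sqrt (frobSq A)

theorem frob_nonneg (A : Matrix m n ℝ) : 0 ≤ frob A := Real.sqrt_nonneg _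

theorem frob_sq (A : Matrix m n ℝ) : frob A ^ 2 = frobSq A := Real.sq_sqrt (frobSq_nonneg A)

theorem frob_eq_norm (A : Matrix m n ℝ) :
    frob A = @norm _ Matrix.frobeniusSeminormedAddCommGroup.toNorm A := by
  rw [Matrix.frobenius_norm_def, frob, frobSq_eq_sum, Real.sqrt_eq_rpow]
  simp

theorem frob_add_le (A B : Matrix m n ℝ) : frob (A + B) ≤ frob A + frob B := by
  simp only [frob_eq_norm]
  exact @norm_add_le _ Matrix.frobeniusSeminormedAddCommGroup.toSeminormedAddGroup A B

theorem frob_neg (A : Matrix m n ℝ) : frob (-A) = frob A := by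
  simp only [frob_eq_norm]
  exact @norm_neg _ Matrix.frobeniusSeminormedAddCommGroup.toSeminormedAddGroup A

theorem frob_sub_le (A B : Matrix m n ℝ) : frob (A - B) ≤ frob A + frob B := by
  rw [sub_eq_add_neg, ← frob_neg B]; exact frob_add_le _ _

theorem frob_mul_le (A : Matrix l m ℝ) (B : Matrix m n ℝ) : frob (A * B) ≤ frob A * frob B := by
  simp only [frob_eq_norm]
  exact Matrix.frobenius_norm_mul A B

theorem frob_transpose (A : Matrix m n ℝ) : frob Aᵀ = frob A := by
  simp only [frob_eq_norm]
  exact Matrix.frobenius_norm_transpose A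

theorem frobSq_smul (c : ℝ) (A : Matrix m n ℝ) : frobSq (c • A) = c ^ 2 * frobSq A := by
  simp [frobSq, Matrix.transpose_smul, smul_smul, sq, mul_assoc]

theorem frob_smul (c : ℝ) (A : Matrix m n ℝ) : frob (c • A) = |c| * frob A := by
  rw [frob, frobSq_smul, Real.sqrt_mul (sq_nonneg c), Real.sqrt_sq_eq_abs, frob]

theorem frob_sum_le {ι : Type*} (s : Finset ι) (A : ι → Matrix m n ℝ) :
    frob (∑ i ∈ s, A i) ≤ ∑ i ∈ s, frob (A i) := by
  simp only [frob_eq_norm]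
  exact @norm_sum_le _ _ Matrix.frobeniusSeminormedAddCommGroup s A

theorem frob_one [DecidableEq m] : frob (1 : Matrix m m ℝ) = Real.sqrt (Fintype.card m) := by
  rw [frob, frobSq]; simp

theorem frobSq_add (A B : Matrix m n ℝ) :
    frobSq (A + B) = frobSq A + 2 * (A * Bᵀ).trace + frobSq B := by
  simp only [frobSq_eq_sum, trace_mul_transpose_eq_sum, Matrix.add_apply, Finset.mul_sum,
    ← Finset.sum_add_distrib]
  exact Finset.sum_congr rfl fun i _ => Finset.sum_congr rfl fun j _ => by ring

theorem abs_trace_mul_transpose_le (A B : Matrix m n ℝ) :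
    |(A * Bᵀ).trace| ≤ frob A * frob B := by
  rw [frob, frob, ← Real.sqrt_mul (frobSq_nonneg A)]
  refine Real.abs_le_sqrt ?_
  rw [trace_mul_transpose_eq_sum, frobSq_eq_sum, frobSq_eq_sum]
  simp only [← Finset.sum_product']
  exact Finset.sum_mul_sq_le_sq_mul_sq _ _ _

theorem frob_mul_le_frob_mul_norm [DecidableEq m] [DecidableEq n] (A : Matrix l m ℝ)
    (B : Matrix m n ℝ) : frob (A * B) ≤ frob A * ‖B‖ := by
  have hrow : ∀ i, ∑ j, (A * B) i j ^ 2 ≤ ‖B‖ ^ 2 * ∑ k, A i k ^ 2 := by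
    intro i
    have h := Matrix.l2_opNorm_mulVec Bᵀ (WithLp.toLp 2 (A i))
    have hB : ‖Bᵀ‖ = ‖B‖ := by
      rw [← Matrix.conjTranspose_eq_transpose_of_trivial, Matrix.l2_opNorm_conjTranspose]
    rw [hB] at h
    have h2 := pow_le_pow_left₀ (norm_nonneg _) h 2
    rw [mul_pow, EuclideanSpace.real_norm_sq_eq, EuclideanSpace.real_norm_sq_eq] at h2
    refine le_trans (le_of_eq (Finset.sum_congr rfl fun j _ => ?_)) h2
    simp [Matrix.mul_apply, Matrix.mulVec, dotProduct, mul_comm]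
  refine Real.sqrt_le_iff.2 ⟨mul_nonneg (frob_nonneg _) (norm_nonneg _), ?_⟩
  rw [mul_pow, frob_sq, frobSq_eq_sum, frobSq_eq_sum, mul_comm, Finset.mul_sum]
  exact Finset.sum_le_sum fun i _ => hrow i

end Frobenius

/-! ### Orthogonal projectors -/

section Projector

variable {m n κ : Type*} [Fintype m] [Fintype n] [Fintype κ]

theorem transpose_symmPinv [DecidableEq n] {S : Matrix n n ℝ} (hS : S.IsHermitian) :
    (symmPinv hS)ᵀ = symmPinv hS := by
  simp [symmPinv, Matrix.transpose_mul, Matrix.mul_assoc]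

/-- The orthogonal projector `A (A'A)† A'` onto the column space of `A`. -/
def colProj [DecidableEq n] (A : Matrix m n ℝ) : Matrix m m ℝ :=
  A * symmPinv (isHermitian_transpose_mul_self A) * Aᵀ

theorem annihilator_eq [DecidableEq m] [DecidableEq n] (A : Matrix m n ℝ) :
    annihilator A = 1 - colProj A := rfl

theorem transpose_colProj [DecidableEq n] (A : Matrix m n ℝ) : (colProj A)ᵀ = colProj A := by
  simp [colProj, Matrix.transpose_mul, transpose_symmPinv, Matrix.mul_assoc]

theorem colProj_mul_self [DecidableEq n] (A : Matrix m n ℝ) : colProj A * A = A := by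
  have hp := (symmPinv_penrose (isHermitian_transpose_mul_self A)).1
  obtain ⟨S, hS⟩ : ∃ S, S = symmPinv (isHermitian_transpose_mul_self A) := ⟨_, rfl⟩
  have hc : colProj A = A * S * Aᵀ := by rw [hS]; rfl
  rw [← hS] at hp
  -- `A' (P A - A) = 0` by the first Penrose equation, and `P A - A = A Z` lies in the range of `A`.
  have h0 : colProj A * A - A = A * (S * (Aᵀ * A) - 1) := by
    rw [hc, Matrix.mul_sub, Matrix.mul_one]; simp only [Matrix.mul_assoc]
  have h1 : Aᵀ * (colProj A * A - A) = 0 := by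
    rw [h0, Matrix.mul_sub, Matrix.mul_one, Matrix.mul_sub, sub_eq_zero]
    simpa only [Matrix.mul_assoc] using hp
  have h2 : (colProj A * A - A)ᴴ * (colProj A * A - A) = 0 := by
    rw [Matrix.conjTranspose_eq_transpose_of_trivial]
    nth_rewrite 1 [h0]
    rw [Matrix.transpose_mul, Matrix.mul_assoc, h1, Matrix.mul_zero]
  exact sub_eq_zero.1 (Matrix.conjTranspose_mul_self_eq_zero.1 h2)

theorem colProj_mul_colProj [DecidableEq n] (A : Matrix m n ℝ) :
    colProj A * colProj A = colProj A := by
  calc colProj A * colProj A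
      = colProj A * A * symmPinv (isHermitian_transpose_mul_self A) * Aᵀ := by
        simp only [Matrix.mul_assoc, colProj]
    _ = colProj A := by rw [colProj_mul_self, colProj]

theorem annihilator_mul_self [DecidableEq m] [DecidableEq n] (A : Matrix m n ℝ) :
    annihilator A * A = 0 := by
  rw [annihilator_eq, Matrix.sub_mul, colProj_mul_self, Matrix.one_mul, sub_self]

theorem transpose_annihilator [DecidableEq m] [DecidableEq n] (A : Matrix m n ℝ) :
    (annihilator A)ᵀ = annihilator A := by
  rw [annihilator_eq, Matrix.transpose_sub, transpose_colProj, Matrix.transpose_one]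

theorem annihilator_mul_annihilator [DecidableEq m] [DecidableEq n] (A : Matrix m n ℝ) :
    annihilator A * annihilator A = annihilator A := by
  rw [annihilator_eq, Matrix.sub_mul, Matrix.one_mul, Matrix.mul_sub, colProj_mul_colProj,
    Matrix.mul_one, sub_self, sub_zero]

/-- The diagonal entries of a symmetric idempotent matrix lie in `[0, 1]`. -/
theorem diag_mem_Icc_of_symm_idem {Q : Matrix n n ℝ} (hs : Qᵀ = Q) (hi : Q * Q = Q) (i : n) :
    0 ≤ Q i i ∧ Q i i ≤ 1 := by
  have h : Q i i = ∑ j, Q i j ^ 2 := by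
    conv_lhs => rw [← hi]
    rw [Matrix.mul_apply]
    refine Finset.sum_congr rfl fun j _ => ?_
    rw [sq, ← Matrix.transpose_apply Q, hs]
  have h0 : 0 ≤ Q i i := by rw [h]; positivity
  have h1 : Q i i ^ 2 ≤ Q i i := by
    conv_rhs => rw [h]
    exact Finset.single_le_sum (f := fun j => Q i j ^ 2) (fun j _ => sq_nonneg _)
      (Finset.mem_univ i)
  exact ⟨h0, by nlinarith⟩

/-- The number of columns bounds the trace, hence the rank, of the projector. The trace is that of
the symmetric idempotent `(A'A)† A'A`, which has as many rows as `A` has columns. -/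
theorem trace_colProj_le [DecidableEq n] (A : Matrix m n ℝ) :
    (colProj A).trace ≤ Fintype.card n := by
  obtain ⟨-, h2, -, h4⟩ := symmPinv_penrose (isHermitian_transpose_mul_self A)
  have htr : (colProj A).trace =
      (symmPinv (isHermitian_transpose_mul_self A) * (Aᵀ * A)).trace := by
    rw [colProj, Matrix.mul_assoc, Matrix.trace_mul_comm, Matrix.mul_assoc]
  rw [htr, Matrix.trace]
  have hi := fun i => (diag_mem_Icc_of_symm_idem h4
    (by rw [← Matrix.mul_assoc, h2]) i).2
  calc _ ≤ ∑ _i : n, (1 : ℝ) := Finset.sum_le_sum fun i _ => hi i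
    _ = _ := by simp

theorem frob_colProj_le [DecidableEq n] (A : Matrix m n ℝ) :
    frob (colProj A) ≤ Real.sqrt (Fintype.card n) := by
  refine Real.sqrt_le_sqrt ?_
  rw [frobSq, transpose_colProj, colProj_mul_colProj]
  exact trace_colProj_le A

theorem frobSq_annihilator_mul_le [DecidableEq m] [DecidableEq n] (A : Matrix m n ℝ)
    (B : Matrix m κ ℝ) :
    frobSq (annihilator A * B) ≤ frobSq B := by
  have hB : B = annihilator A * B + colProj A * B := by
    rw [← Matrix.add_mul, annihilator_eq, sub_add_cancel, Matrix.one_mul]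
  have ho : (annihilator A * B * (colProj A * B)ᵀ).trace = 0 := by
    rw [Matrix.transpose_mul, transpose_colProj, Matrix.trace_mul_comm]
    have : colProj A * annihilator A = 0 := by
      rw [annihilator_eq, Matrix.mul_sub, colProj_mul_colProj, Matrix.mul_one, sub_self]
    rw [← Matrix.mul_assoc, Matrix.mul_assoc Bᵀ, this]
    simp
  conv_rhs => rw [hB]
  rw [frobSq_add, ho]
  linarith [frobSq_nonneg (colProj A * B)]

/-- Trace duality for a low-rank matrix: `|⟨E, U V'⟩| ≤ √(rank) ‖E‖ ‖U V'‖_F`, the number of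
columns of `U` standing in for the rank. -/
theorem abs_trace_mul_transpose_le_of_factor [DecidableEq m] [DecidableEq n]
    [DecidableEq κ] (E : Matrix m n ℝ) (U : Matrix m κ ℝ)
    (V : Matrix n κ ℝ) :
    |((U * Vᵀ) * Eᵀ).trace| ≤ Real.sqrt (Fintype.card κ) * ‖E‖ * frob (U * Vᵀ) := by
  have h : ((U * Vᵀ) * Eᵀ).trace = ((U * Vᵀ) * (colProj U * E)ᵀ).trace := by
    rw [Matrix.transpose_mul, transpose_colProj, ← Matrix.mul_assoc,
      Matrix.trace_mul_comm _ (colProj U), ← Matrix.mul_assoc, ← Matrix.mul_assoc, colProj_mul_self]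
  rw [h, mul_comm]
  refine (abs_trace_mul_transpose_le _ _).trans ?_
  refine mul_le_mul_of_nonneg_left ?_ (frob_nonneg _)
  exact (frob_mul_le_frob_mul_norm _ _).trans
    (mul_le_mul_of_nonneg_right (frob_colProj_le U) (norm_nonneg _))

end Projector

/-! ### The Eckart-Young lower bound -/

section EckartYoung

/-- Among weights in `[0, 1]` of total mass at most `k`, those concentrated on the first `k` terms
capture the most of a decreasing nonnegative sequence. -/
theorem sum_tail_le_of_antitone {N : ℕ} {f p : Fin N → ℝ} (hf : Antitone f) (hf0 : ∀ i, 0 ≤ f i)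
    (hp : ∀ i, 0 ≤ p i ∧ p i ≤ 1) {k : ℕ} (hk : ∑ i, p i ≤ k) :
    ∑ i ∈ Finset.univ.filter (fun i : Fin N => k ≤ (i : ℕ)), f i ≤ ∑ i, (1 - p i) * f i := by
  rcases le_or_gt N k with hN | hN
  · rw [Finset.filter_false_of_mem fun i _ => not_le.2 (i.2.trans_le hN), Finset.sum_empty]
    exact Finset.sum_nonneg fun i _ => mul_nonneg (by linarith [(hp i).2]) (hf0 i)
  -- Compare every `f i` with the threshold `f k`.
  set c := f ⟨k, hN⟩
  have hterm : ∀ i : Fin N, (if k ≤ (i : ℕ) then f i else 0) + c * ((if (i : ℕ) < k then 1 else 0)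
      - p i) ≤ (1 - p i) * f i := by
    intro i
    by_cases hi : k ≤ (i : ℕ)
    · have : f i ≤ c := hf (show (⟨k, hN⟩ : Fin N) ≤ i from hi)
      rw [if_pos hi, if_neg (not_lt.2 hi)]
      nlinarith [(hp i).1]
    · have : c ≤ f i := hf (show i ≤ (⟨k, hN⟩ : Fin N) from (not_le.1 hi).le)
      rw [if_neg hi, if_pos (not_le.1 hi)]
      nlinarith [(hp i).2]
  have hcard : ∑ i : Fin N, (if (i : ℕ) < k then (1 : ℝ) else 0) = k := by
    rw [Fin.sum_univ_eq_sum_range (fun i => if i < k then (1 : ℝ) else 0) N,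
      ← Finset.sum_filter]
    have : Finset.filter (fun i => i < k) (Finset.range N) = Finset.range k := by
      ext; simp; omega
    simp [this]
  have hsum := Finset.sum_le_sum fun i (_ : i ∈ Finset.univ) => hterm i
  rw [Finset.sum_add_distrib, ← Finset.mul_sum, Finset.sum_sub_distrib, hcard,
    ← Finset.sum_filter] at hsum
  have : 0 ≤ c * (k - ∑ i, p i) := mul_nonneg (hf0 _) (by linarith)
  linarith

variable {m n κ : Type*} [Fintype m] [Fintype n] [Fintype κ]

/-- Ky Fan's inequality: an orthogonal projector `P` of rank at most `k` captures at most the `k`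
largest eigenvalues of `S`. The weights in `sum_tail_le_of_antitone` are the diagonal entries of `P`
in an eigenbasis of `S`. -/
theorem eigTailSum_le_trace_sub [DecidableEq n] {S P : Matrix n n ℝ} (hS : S.IsHermitian)
    (hpos : S.PosSemidef)
    (hPs : Pᵀ = P) (hPi : P * P = P) {k : ℕ} (hk : P.trace ≤ k) :
    eigTailSum hS k ≤ ((1 - P) * S).trace := by
  obtain ⟨U, hU⟩ : ∃ U : Matrix n n ℝ, U = (hS.eigenvectorUnitary : Matrix n n ℝ) := ⟨_, rfl⟩
  have hUU : Uᵀ * U = 1 := by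
    have h := Matrix.mem_unitaryGroup_iff'.1 hS.eigenvectorUnitary.2
    rw [← hU, Matrix.star_eq_conjTranspose, Matrix.conjTranspose_eq_transpose_of_trivial] at h
    exact h
  have hUU' : U * Uᵀ = 1 := mul_eq_one_comm.1 hUU
  have hS' : S = U * Matrix.diagonal hS.eigenvalues * Uᵀ := by
    have h := hS.spectral_theorem
    rw [Unitary.conjStarAlgAut_apply, ← hU, Matrix.star_eq_conjTranspose,
      Matrix.conjTranspose_eq_transpose_of_trivial] at h
    simpa using h
  set Q := Uᵀ * P * U with hQ
  have hQs : Qᵀ = Q := by simp [hQ, Matrix.transpose_mul, hPs, Matrix.mul_assoc]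
  have hQi : Q * Q = Q := by
    calc Q * Q = Uᵀ * (P * (U * Uᵀ) * P) * U := by simp only [hQ, Matrix.mul_assoc]
      _ = Q := by rw [hUU', Matrix.mul_one, hPi]
  have hQt : Q.trace = P.trace := by
    rw [hQ, Matrix.trace_mul_comm, ← Matrix.mul_assoc, hUU', Matrix.one_mul]
  have htr : ((1 - P) * S).trace = ∑ i, (1 - Q i i) * hS.eigenvalues i := by
    have : (((1 - P) * S).trace) = ((1 - Q) * Matrix.diagonal hS.eigenvalues).trace := by
      have h1 : (1 - Q) = Uᵀ * (1 - P) * U := by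
        rw [Matrix.mul_sub, Matrix.sub_mul, Matrix.mul_one, hUU]
      conv_lhs => rw [hS']
      rw [h1, ← Matrix.mul_assoc, Matrix.trace_mul_comm]
      simp only [Matrix.mul_assoc]
    rw [this, Matrix.trace]
    simp [Matrix.mul_diagonal, Matrix.sub_apply]
  let σ : Fin (Fintype.card n) ≃ n := Fintype.equivOfCardEq (Fintype.card_fin _)
  have hσ : ∀ r, hS.eigenvalues (σ r) = hS.eigenvalues₀ r := by
    intro r
    simp [Matrix.IsHermitian.eigenvalues, σ]
  have h0 : ∀ r, 0 ≤ hS.eigenvalues₀ r := fun r => by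
    rw [← hσ]; exact hpos.eigenvalues_nonneg _
  rw [htr, ← σ.sum_comp]
  simp only [hσ]
  refine sum_tail_le_of_antitone (p := fun r => Q (σ r) (σ r)) hS.eigenvalues₀_antitone h0
    (fun r => diag_mem_Icc_of_symm_idem hQs hQi _) ?_
  rw [σ.sum_comp fun i => Q i i]
  exact hQt.le.trans hk

/-- Eckart-Young: the squared Frobenius distance from `A` to a matrix of rank at most `k` is at
least the sum of all but the `k` largest eigenvalues of `A A'`. The rank condition is expressed by a
factorization `U V'` with `k` columns. -/
theorem eigTailSum_le_frobSq_sub [DecidableEq m] [DecidableEq κ]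
    {S : Matrix m m ℝ} (hS : S.IsHermitian) {A : Matrix m n ℝ}
    (hSA : S = A * Aᵀ) (U : Matrix m κ ℝ) (V : Matrix n κ ℝ) :
    eigTailSum hS (Fintype.card κ) ≤ frobSq (A - U * Vᵀ) := by
  have hpos : S.PosSemidef := by
    rw [hSA, ← Matrix.conjTranspose_eq_transpose_of_trivial]
    exact Matrix.posSemidef_self_mul_conjTranspose A
  refine (eigTailSum_le_trace_sub hS hpos (transpose_colProj U) (colProj_mul_colProj U)
    (trace_colProj_le U)).trans ?_
  refine le_trans (le_of_eq ?_) (frobSq_annihilator_mul_le U _)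
  rw [Matrix.mul_sub, ← Matrix.mul_assoc (annihilator U) U, annihilator_mul_self, Matrix.zero_mul,
    sub_zero, frobSq, Matrix.transpose_mul, transpose_annihilator, ← Matrix.mul_assoc,
    Matrix.trace_mul_comm _ (annihilator U), ← Matrix.mul_assoc, ← Matrix.mul_assoc,
    annihilator_mul_annihilator, annihilator_eq, hSA, Matrix.mul_assoc]

end EckartYoung

/-! ### Separating low-rank regressors from the factor structure -/

section LowRank

variable {m n r κ : Type*} [Fintype m] [Fintype n] [Fintype r] [Fintype κ]

theorem isUnit_one_sub_of_frob_lt_one [DecidableEq r] {E : Matrix r r ℝ} (hE : frob E < 1) :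
    IsUnit (1 - E) := by
  rw [Matrix.isUnit_iff_isUnit_det, isUnit_iff_ne_zero]
  intro h0
  obtain ⟨v, hv0, hv⟩ := Matrix.exists_mulVec_eq_zero_iff.2 h0
  obtain ⟨x, hx⟩ : ∃ x : Matrix r Unit ℝ, x = Matrix.replicateCol Unit v := ⟨_, rfl⟩
  have hEx : x = E * x := by
    rw [Matrix.sub_mulVec, Matrix.one_mulVec, sub_eq_zero] at hv
    rw [hx, ← Matrix.replicateCol_mulVec, ← hv]
  have h1 : frob x ≤ frob E * frob x := by
    conv_lhs => rw [hEx]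
    exact frob_mul_le _ _
  have h2 : frob x = 0 := by nlinarith [frob_nonneg x]
  have h4 : frobSq x = 0 := by rw [← frob_sq, h2]; norm_num
  refine hv0 (funext fun i => ?_)
  rw [frobSq_eq_sum, Finset.sum_eq_zero_iff_of_nonneg fun _ _ => by positivity] at h4
  simpa [hx] using h4 i (Finset.mem_univ i)

/-- If `L' M_w L > B 𝕀`, then `L` has a left inverse that kills `w` and whose Frobenius norm is
bounded in terms of `B` alone: `(L' M_w L)⁻¹ L' M_w`. -/
theorem exists_leftInverse_of_posDef [DecidableEq m] [DecidableEq r] [DecidableEq κ]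
    (L : Matrix m r ℝ) (w : Matrix m κ ℝ) {B : ℝ} (hB : 0 < B)
    (h : (Lᵀ * annihilator w * L - B • (1 : Matrix r r ℝ)).PosDef) :
    ∃ P : Matrix r m ℝ, P * L = 1 ∧ P * w = 0 ∧ frob P ≤ Real.sqrt (Fintype.card r / B) := by
  obtain ⟨S, hS⟩ : ∃ S, S = Lᵀ * annihilator w * L := ⟨_, rfl⟩
  rw [← hS] at h
  have hSpos : S.PosDef := by
    have h2 := h.add_posSemidef ((Matrix.PosSemidef.one (n := r) (R := ℝ)).smul hB.le)
    rwa [sub_add_cancel] at h2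
  have hdet : IsUnit S.det := hSpos.det_pos.ne'.isUnit
  have hSt : Sᵀ = S := by
    rw [hS]; simp [Matrix.transpose_mul, transpose_annihilator, Matrix.mul_assoc]
  have hZt : (S⁻¹)ᵀ = S⁻¹ := by rw [Matrix.transpose_nonsing_inv, hSt]
  refine ⟨S⁻¹ * (Lᵀ * annihilator w), ?_, ?_, Real.sqrt_le_sqrt ?_⟩
  · rw [Matrix.mul_assoc, ← hS, Matrix.nonsing_inv_mul _ hdet]
  · rw [Matrix.mul_assoc, Matrix.mul_assoc, annihilator_mul_self, Matrix.mul_zero,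
      Matrix.mul_zero]
  have hP : frobSq (S⁻¹ * (Lᵀ * annihilator w)) = (S⁻¹).trace := by
    have : S⁻¹ * (Lᵀ * annihilator w) * (S⁻¹ * (Lᵀ * annihilator w))ᵀ = S⁻¹ := by
      calc S⁻¹ * (Lᵀ * annihilator w) * (S⁻¹ * (Lᵀ * annihilator w))ᵀ
          = S⁻¹ * (Lᵀ * (annihilator w * annihilator w) * L) * S⁻¹ := by
            simp only [Matrix.transpose_mul, transpose_annihilator, hZt,
              Matrix.transpose_transpose, Matrix.mul_assoc]
        _ = S⁻¹ := by
            rw [annihilator_mul_annihilator, ← hS, Matrix.nonsing_inv_mul _ hdet, Matrix.one_mul]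
    rw [frobSq, this]
  -- `B ‖S⁻¹‖_F² ≤ Tr (S⁻¹ S S⁻¹) = Tr S⁻¹ ≤ √r ‖S⁻¹‖_F`, and both ends together bound `Tr S⁻¹`.
  have h1 : B * frob S⁻¹ ^ 2 ≤ (S⁻¹).trace := by
    have h2 := (h.posSemidef.mul_mul_conjTranspose_same S⁻¹).trace_nonneg
    rw [Matrix.conjTranspose_eq_transpose_of_trivial, Matrix.mul_sub, Matrix.sub_mul,
      Matrix.nonsing_inv_mul _ hdet, Matrix.one_mul, hZt, Matrix.trace_sub] at h2
    have h3 : (S⁻¹ * B • (1 : Matrix r r ℝ) * S⁻¹).trace = B * frob S⁻¹ ^ 2 := by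
      rw [frob_sq, frobSq, hZt]; simp
    linarith
  have h4 : (S⁻¹).trace ≤ frob S⁻¹ * Real.sqrt (Fintype.card r) := by
    have h5 := abs_trace_mul_transpose_le S⁻¹ (1 : Matrix r r ℝ)
    rw [frob_one, Matrix.transpose_one, Matrix.mul_one] at h5
    exact (le_abs_self _).trans h5
  rw [hP, le_div_iff₀ hB]
  have hr : Real.sqrt (Fintype.card r) ^ 2 = Fintype.card r :=
    Real.sq_sqrt (Nat.cast_nonneg _)
  nlinarith [sq_nonneg (B * frob S⁻¹ - Real.sqrt (Fintype.card r)), frob_nonneg S⁻¹,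
    Real.sqrt_nonneg (Fintype.card r : ℝ)]

/-- If `P` and `Q` invert `L` and `F'` from the outside and annihilate `D` from either side, then a
matrix `l f'` of rank at most that of `L F'` can be close to `D + L F'` only if `D` is small.
Indeed `C = l f'` satisfies `C = C Q (P C Q)⁻¹ P C`, while the same expression in `D + L F'`
equals `L F'`. -/
theorem frob_le_of_frob_add_sub_le [DecidableEq r] {L l : Matrix m r ℝ} {F f : Matrix n r ℝ}
    {D : Matrix m n ℝ} {P : Matrix r m ℝ} {Q : Matrix n r ℝ} (hPL : P * L = 1)
    (hFQ : Fᵀ * Q = 1) (hPD : P * D = 0) (hDQ : D * Q = 0) {p H η : ℝ} (hP : frob P ≤ p)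
    (hQ : frob Q ≤ p) (hL : frob L ≤ H) (hF : frob F ≤ H) (hη : η ≤ 1) (hpη : η * p ^ 2 ≤ 1 / 2)
    (h : frob (D + L * Fᵀ - l * fᵀ) ≤ η) :
    frob D ≤ (1 + 2 * p * Real.sqrt (Fintype.card r) * (H + p)
      + H * (2 * p ^ 2 * Real.sqrt (Fintype.card r)) * (H + p) + H * p) * η := by
  have hp0 : 0 ≤ p := (frob_nonneg P).trans hP
  have hH0 : 0 ≤ H := (frob_nonneg L).trans hL
  have hη0 : 0 ≤ η := (frob_nonneg _).trans h
  obtain ⟨s, hs⟩ : ∃ s, s = Real.sqrt (Fintype.card r) := ⟨_, rfl⟩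
  have hs0 : 0 ≤ s := hs ▸ Real.sqrt_nonneg _
  rw [← hs]
  obtain ⟨E, hE⟩ : ∃ E, E = D + L * Fᵀ - l * fᵀ := ⟨_, rfl⟩
  obtain ⟨C, hC⟩ : ∃ C, C = l * fᵀ := ⟨_, rfl⟩
  have hCE : C = D + L * Fᵀ - E := by rw [hC, hE]; abel
  have hEη : frob E ≤ η := hE ▸ h
  have hPC : P * C = Fᵀ - P * E := by
    rw [hCE, Matrix.mul_sub, Matrix.mul_add, hPD, ← Matrix.mul_assoc, hPL, Matrix.one_mul,
      zero_add]
  have hCQ : C * Q = L - E * Q := by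
    rw [hCE, Matrix.sub_mul, Matrix.add_mul, hDQ, Matrix.mul_assoc, hFQ, Matrix.mul_one, zero_add]
  have hW : P * C * Q = 1 - P * E * Q := by
    rw [hPC, Matrix.sub_mul, hFQ]
  have hPE : frob (P * E) ≤ η * p := by
    refine (frob_mul_le _ _).trans ?_
    rw [mul_comm]; exact mul_le_mul hEη hP (frob_nonneg _) hη0
  have hEQ : frob (E * Q) ≤ η * p :=
    (frob_mul_le _ _).trans (mul_le_mul hEη hQ (frob_nonneg _) hη0)
  have hPEQ : frob (P * E * Q) ≤ η * p ^ 2 := by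
    refine (frob_mul_le _ _).trans ?_
    rw [sq, ← mul_assoc]
    exact mul_le_mul hPE hQ (frob_nonneg _) (by positivity)
  have hWu : IsUnit (P * C * Q) := by
    rw [hW]; exact isUnit_one_sub_of_frob_lt_one (by linarith)
  have hWdet : IsUnit (P * C * Q).det := (Matrix.isUnit_iff_isUnit_det _).1 hWu
  obtain ⟨M, hM⟩ : ∃ M, M = (P * C * Q)⁻¹ := ⟨_, rfl⟩
  have hfac : P * C * Q = (P * l) * (fᵀ * Q) := by rw [hC]; simp only [Matrix.mul_assoc]
  have hCC : C = C * Q * M * (P * C) := by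
    have hd : IsUnit ((P * l).det * (fᵀ * Q).det) := by
      rw [← Matrix.det_mul, ← hfac]; exact hWdet
    have h1 := isUnit_of_mul_isUnit_left hd
    have h2 := isUnit_of_mul_isUnit_right hd
    rw [hM, hfac, Matrix.mul_inv_rev, hC]
    calc l * fᵀ = l * ((fᵀ * Q) * (fᵀ * Q)⁻¹) * ((P * l)⁻¹ * (P * l)) * fᵀ := by
          rw [Matrix.mul_nonsing_inv _ h2, Matrix.nonsing_inv_mul _ h1, Matrix.mul_one,
            Matrix.mul_one]
      _ = _ := by simp only [Matrix.mul_assoc]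
  -- `M` is the perturbation `𝕀 + N` of the identity, `N = (P E Q) M`.
  have hM1 : M = 1 + P * E * Q * M := by
    have h1 : (1 - P * E * Q) * M = 1 := by rw [← hW, hM, Matrix.mul_nonsing_inv _ hWdet]
    rw [Matrix.sub_mul, Matrix.one_mul] at h1
    rw [← h1]; abel
  have hMs : frob M ≤ 2 * s := by
    have h1 : frob M ≤ s + 1 / 2 * frob M := by
      calc frob M = frob (1 + P * E * Q * M) := by rw [← hM1]
        _ ≤ frob (1 : Matrix r r ℝ) + frob (P * E * Q * M) := frob_add_le _ _
        _ ≤ s + 1 / 2 * frob M := by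
          rw [frob_one, ← hs]
          gcongr
          exact (frob_mul_le _ _).trans
            (mul_le_mul_of_nonneg_right (hPEQ.trans hpη) (frob_nonneg _))
    linarith
  have hN : frob (P * E * Q * M) ≤ η * p ^ 2 * (2 * s) :=
    (frob_mul_le _ _).trans (mul_le_mul hPEQ hMs (frob_nonneg _) (by positivity))
  have hPCn : frob (P * C) ≤ H + p := by
    rw [hPC]
    refine (frob_sub_le _ _).trans ?_
    rw [frob_transpose]
    nlinarith
  have hdiff : D = E - E * Q * M * (P * C) + L * (P * E * Q * M) * (P * C) - L * (P * E) := by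
    have h1 : C = (L - E * Q) * M * (P * C) := by rw [← hCQ]; exact hCC
    have h2 : L * M * (P * C) = L * (P * C) + L * (P * E * Q * M) * (P * C) := by
      conv_lhs => rw [hM1]
      rw [Matrix.mul_add, Matrix.add_mul, Matrix.mul_one]
    rw [Matrix.sub_mul, Matrix.sub_mul, h2] at h1
    have h3 : L * (P * C) = L * Fᵀ - L * (P * E) := by rw [hPC, Matrix.mul_sub]
    rw [h3] at h1
    have h4 : D = C - L * Fᵀ + E := by rw [hCE]; abel
    rw [h4]
    nth_rewrite 1 [h1]
    abel
  have t1 : frob (E * Q * M * (P * C)) ≤ η * p * (2 * s) * (H + p) := by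
    refine (frob_mul_le _ _).trans (mul_le_mul ?_ hPCn (frob_nonneg _) (by positivity))
    exact (frob_mul_le _ _).trans (mul_le_mul hEQ hMs (frob_nonneg _) (by positivity))
  have t2 : frob (L * (P * E * Q * M) * (P * C)) ≤ H * (η * p ^ 2 * (2 * s)) * (H + p) := by
    refine (frob_mul_le _ _).trans (mul_le_mul ?_ hPCn (frob_nonneg _) (by positivity))
    exact (frob_mul_le _ _).trans (mul_le_mul hL hN (frob_nonneg _) hH0)
  have t3 : frob (L * (P * E)) ≤ H * (η * p) :=
    (frob_mul_le _ _).trans (mul_le_mul hL hPE (frob_nonneg _) hH0)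
  rw [hdiff]
  have u1 := frob_sub_le (E - E * Q * M * (P * C) + L * (P * E * Q * M) * (P * C)) (L * (P * E))
  have u2 := frob_add_le (E - E * Q * M * (P * C)) (L * (P * E * Q * M) * (P * C))
  have u3 := frob_sub_le E (E * Q * M * (P * C))
  linarith

end LowRank

/-! ### Near-minimizers of the least squares objective -/

section NearMinimizer

variable {m n κ : Type*}

theorem mul_transpose_sub_mul_transpose {r : Type*} [Fintype r] (L l : Matrix m r ℝ)
    (F f : Matrix n r ℝ) :
    L * Fᵀ - l * fᵀ = Matrix.fromCols L l * (Matrix.fromCols F (-f))ᵀ := by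
  rw [Matrix.transpose_fromCols, Matrix.fromCols_mul_fromRows, Matrix.transpose_neg,
    Matrix.mul_neg, sub_eq_add_neg]

variable [Fintype m] [Fintype n] [Fintype κ] [DecidableEq m] [DecidableEq n] [DecidableEq κ]

/-- If `D + G + e`, with `G` of low rank, is essentially no larger than `e`, and `e` is nearly
orthogonal to `D` and has small spectral norm, then `D + G` is small. -/
theorem frob_add_sq_le {D e : Matrix m n ℝ} (U : Matrix m κ ℝ) (V : Matrix n κ ℝ) {ε h a : ℝ}
    (hmin : frobSq (D + U * Vᵀ + e) ≤ frobSq e + ε) (hDe : |(D * eᵀ).trace| ≤ ε * a)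
    (he : ‖e‖ ≤ ε) (hD : frob D ≤ h) :
    frob (D + U * Vᵀ) ^ 2 ≤ ε * (1 + 2 * a
      + 2 * Real.sqrt (Fintype.card κ) * (frob (D + U * Vᵀ) + h)) := by
  rw [frobSq_add (D + U * Vᵀ) e, ← frob_sq (D + U * Vᵀ), Matrix.add_mul, Matrix.trace_add] at hmin
  have hG : frob (U * Vᵀ) ≤ frob (D + U * Vᵀ) + h := by
    have h1 := frob_sub_le (D + U * Vᵀ) D
    rw [add_sub_cancel_left] at h1
    linarith
  have hε : 0 ≤ ε := (norm_nonneg e).trans he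
  have hGe : |(U * Vᵀ * eᵀ).trace| ≤
      Real.sqrt (Fintype.card κ) * ε * (frob (D + U * Vᵀ) + h) :=
    (abs_trace_mul_transpose_le_of_factor e U V).trans
      (mul_le_mul (mul_le_mul_of_nonneg_left he (Real.sqrt_nonneg _)) hG (frob_nonneg _)
        (by positivity))
  nlinarith [neg_abs_le (D * eᵀ).trace, neg_abs_le (U * Vᵀ * eᵀ).trace]

end NearMinimizer

/-! ### The deterministic consistency bound -/

section Deterministic

theorem abs_apply_le_norm {ι : Type*} [Fintype ι] (x : EuclideanSpace ℝ ι) (i : ι) :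
    |x i| ≤ ‖x‖ := by
  simpa using PiLp.norm_apply_le x i

theorem frob_sum_smul_le {ι m n : Type*} [Fintype ι] [Fintype m] [Fintype n]
    {X : ι → Matrix m n ℝ} {H : ℝ} (hX : ∀ k, frob (X k) ≤ H) (x : EuclideanSpace ℝ ι) :
    frob (∑ k, x k • X k) ≤ Fintype.card ι * H * ‖x‖ := by
  refine (frob_sum_le _ _).trans ?_
  calc ∑ k, frob (x k • X k) ≤ ∑ _k : ι, H * ‖x‖ := by
        refine Finset.sum_le_sum fun k _ => ?_
        rw [frob_smul, mul_comm]
        exact mul_le_mul (hX k) (abs_apply_le_norm x k) (abs_nonneg _)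
          ((frob_nonneg _).trans (hX k))
    _ = Fintype.card ι * H * ‖x‖ := by simp [mul_assoc]

theorem abs_trace_sum_smul_le {ι m n : Type*} [Fintype ι] [Fintype m] [Fintype n]
    {X : ι → Matrix m n ℝ} {e : Matrix m n ℝ} {ε : ℝ} (hX : ∀ k, |(X k * eᵀ).trace| ≤ ε)
    (x : EuclideanSpace ℝ ι) :
    |((∑ k, x k • X k) * eᵀ).trace| ≤ ε * (Fintype.card ι * ‖x‖) := by
  rw [Matrix.sum_mul, Matrix.trace_sum]
  refine (Finset.abs_sum_le_sum_abs _ _).trans ?_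
  calc ∑ k, |(x k • X k * eᵀ).trace| ≤ ∑ _k : ι, ε * ‖x‖ := by
        refine Finset.sum_le_sum fun k _ => ?_
        rw [Matrix.smul_mul, Matrix.trace_smul, smul_eq_mul, abs_mul, mul_comm]
        exact mul_le_mul (hX k) (abs_apply_le_norm x k) (abs_nonneg _)
          ((abs_nonneg _).trans (hX k))
    _ = ε * (Fintype.card ι * ‖x‖) := by simp; ring

/-- The eigenvalue condition on unit combinations of the regressors bounds every combination away
from the matrices of rank at most `k`. -/
theorem norm_sq_mul_le_frobSq_add {ι m n κ : Type*} [Fintype ι] [Fintype m] [Fintype n]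
    [Fintype κ] [DecidableEq m] [DecidableEq κ] {X : ι → Matrix m n ℝ} {b : ℝ}
    (hb : ∀ α : EuclideanSpace ℝ ι, ‖α‖ = 1 →
      ∀ hS : ((∑ k, α k • X k) * (∑ k, α k • X k)ᵀ).IsHermitian,
        b ≤ eigTailSum hS (Fintype.card κ))
    (x : EuclideanSpace ℝ ι) (U : Matrix m κ ℝ) (V : Matrix n κ ℝ) :
    ‖x‖ ^ 2 * b ≤ frobSq (∑ k, x k • X k + U * Vᵀ) := by
  rcases eq_or_ne x 0 with rfl | hx
  · simpa using frobSq_nonneg (U * Vᵀ)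
  have hx' : ‖x‖ ≠ 0 := norm_ne_zero_iff.2 hx
  obtain ⟨α, hα⟩ : ∃ α, α = ‖x‖⁻¹ • x := ⟨_, rfl⟩
  have hα1 : ‖α‖ = 1 := by rw [hα, norm_smul, norm_inv, norm_norm, inv_mul_cancel₀ hx']
  have hS : ((∑ k, α k • X k) * (∑ k, α k • X k)ᵀ).IsHermitian := by
    simpa using isHermitian_smul_self_mul_transpose 1 (∑ k, α k • X k)
  have h1 := (hb α hα1 hS).trans (eigTailSum_le_frobSq_sub hS rfl (-(‖x‖⁻¹ • U)) V)
  have h2 : ∑ k, x k • X k + U * Vᵀ = ‖x‖ • (∑ k, α k • X k - -(‖x‖⁻¹ • U) * Vᵀ) := by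
    simp only [hα, PiLp.smul_apply, smul_eq_mul, Matrix.neg_mul, sub_neg_eq_add, smul_add,
      Finset.smul_sum, smul_smul, Matrix.smul_mul, mul_inv_cancel_left₀ hx', one_smul,
      mul_inv_cancel₀ hx']
  rw [h2, frobSq_smul]
  exact mul_le_mul_of_nonneg_left h1 (sq_nonneg _)

theorem le_of_sq_le_mul_one_add {x δ τ : ℝ} (hδ : 0 < δ) (h : x ^ 2 ≤ τ * (1 + x))
    (hτ : τ * (1 + δ) < δ ^ 2) : x ≤ δ := by
  by_contra! hcon
  have h3 : τ * (1 + δ) * (1 + x) < δ ^ 2 * (1 + x) :=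
    mul_lt_mul_of_pos_right hτ (by linarith)
  have h4 : x ^ 2 * (1 + δ) ≤ τ * (1 + x) * (1 + δ) :=
    mul_le_mul_of_nonneg_right h (by linarith)
  have h5 : 0 < (x - δ) * (x + δ + x * δ) :=
    mul_pos (sub_pos.2 hcon) (by have := mul_pos (hδ.trans hcon) hδ; linarith)
  linarith

/-- If `d · X` is within `δ` of a difference `l f' - L F'` of two factor structures, then it is
itself of order `δ`: the eigenvalue condition makes its high-rank part small, and the part of `L`
and `F` orthogonal to `w` and `v` then separates its low-rank part from the factors. -/
theorem frob_sum_smul_le_of_frob_add_le {K₁ K₂ R N T : ℕ} {b B H δ p C₂ C₃ : ℝ} (hb : 0 < b)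
    (hB : 0 < B) (hp : p = Real.sqrt ((Fintype.card (Fin R) : ℝ) / B))
    (hC₂ : C₂ = 1 + Fintype.card (Fin K₂) * H * (Real.sqrt b)⁻¹)
    (hC₃ : C₃ = 1 + 2 * p * Real.sqrt (Fintype.card (Fin R)) * (H + p)
      + H * (2 * p ^ 2 * Real.sqrt (Fintype.card (Fin R))) * (H + p) + H * p)
    (h1 : C₂ * δ ≤ 1) (h2 : C₂ * δ * p ^ 2 ≤ 1 / 2)
    {X : Fin K₁ ⊕ Fin K₂ → Matrix (Fin N) (Fin T) ℝ} {L l : Matrix (Fin N) (Fin R) ℝ}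
    {F f : Matrix (Fin T) (Fin R) ℝ} {w : Matrix (Fin N) (Fin K₁) ℝ}
    {v : Matrix (Fin T) (Fin K₁) ℝ} {a : ℝ} {d : EuclideanSpace ℝ (Fin K₁ ⊕ Fin K₂)}
    (hX : ∀ k, frob (X k) ≤ H) (hL : frob L ≤ H) (hF : frob F ≤ H)
    (hhigh : ∀ α : EuclideanSpace ℝ (Fin K₂), ‖α‖ = 1 →
      ∀ hS : ((∑ k, α k • X (Sum.inr k)) * (∑ k, α k • X (Sum.inr k))ᵀ).IsHermitian,
        b ≤ eigTailSum hS (2 * R + K₁))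
    (hlow : ∀ j, X (Sum.inl j) = a • Matrix.vecMulVec (fun i => w i j) (fun t => v t j))
    (hw : (Lᵀ * annihilator w * L - B • (1 : Matrix (Fin R) (Fin R) ℝ)).PosDef)
    (hv : (Fᵀ * annihilator v * F - B • (1 : Matrix (Fin R) (Fin R) ℝ)).PosDef)
    (hxδ : frob (∑ k, d k • X k + (L * Fᵀ - l * fᵀ)) ≤ δ) :
    frob (∑ k, d k • X k) ≤ (C₃ + 1) * C₂ * δ := by
  have hH : 0 ≤ H := (frob_nonneg L).trans hL
  have hδ0 : 0 ≤ δ := (frob_nonneg _).trans hxδ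
  have hsb : 0 < Real.sqrt b := Real.sqrt_pos.2 hb
  obtain ⟨D, hD⟩ : ∃ D, D = ∑ k, d k • X k := ⟨_, rfl⟩
  rw [← hD] at hxδ ⊢
  obtain ⟨dh, hdh⟩ : ∃ y : EuclideanSpace ℝ (Fin K₂), y = WithLp.toLp 2 fun k => d (Sum.inr k) :=
    ⟨_, rfl⟩
  obtain ⟨Dh, hDh⟩ : ∃ D, D = ∑ k, dh k • X (Sum.inr k) := ⟨_, rfl⟩
  obtain ⟨v', hv'⟩ : ∃ v', v' = v * Matrix.diagonal fun j => a * d (Sum.inl j) := ⟨_, rfl⟩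
  have hDsum : D = w * v'ᵀ + Dh := by
    rw [hD, Fintype.sum_sum_type, hDh, hdh]
    congr 1
    ext i t
    have hva : ∀ j, v' t j = v t j * (a * d (Sum.inl j)) := fun j => by
      rw [hv', Matrix.mul_diagonal]
    simp only [hlow, Matrix.sum_apply, Matrix.smul_apply, Matrix.vecMulVec_apply,
      smul_eq_mul, Matrix.mul_apply, Matrix.transpose_apply, hva]
    exact Finset.sum_congr rfl fun j _ => by ring
  have hdhδ : ‖dh‖ ≤ δ * (Real.sqrt b)⁻¹ := by
    have h1 := norm_sq_mul_le_frobSq_add (κ := Fin K₁ ⊕ (Fin R ⊕ Fin R))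
      (X := fun k => X (Sum.inr k)) (b := b)
      (by
        have hcard : Fintype.card (Fin K₁ ⊕ (Fin R ⊕ Fin R)) = 2 * R + K₁ := by
          simp; ring
        rw [hcard]; exact hhigh)
      dh (Matrix.fromCols w (Matrix.fromCols L l)) (Matrix.fromCols v' (Matrix.fromCols F (-f)))
    rw [Matrix.transpose_fromCols v', Matrix.fromCols_mul_fromRows,
      ← mul_transpose_sub_mul_transpose, ← hDh, ← add_assoc, add_comm Dh, ← hDsum, ← frob_sq] at h1
    rw [← div_eq_mul_inv, le_div_iff₀ hsb]
    refine le_of_sq_le_sq ?_ hδ0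
    rw [mul_pow, Real.sq_sqrt hb.le]
    exact h1.trans (pow_le_pow_left₀ (frob_nonneg _) hxδ 2)
  have hDhδ : frob Dh ≤ Fintype.card (Fin K₂) * H * (Real.sqrt b)⁻¹ * δ := by
    rw [hDh]
    refine (frob_sum_smul_le (fun k => hX (Sum.inr k)) dh).trans ?_
    rw [mul_assoc _ _ δ, mul_comm _ δ]
    exact mul_le_mul_of_nonneg_left hdhδ (by positivity)
  have hlowδ : frob (w * v'ᵀ + L * Fᵀ - l * fᵀ) ≤ C₂ * δ := by
    have h1 : w * v'ᵀ + L * Fᵀ - l * fᵀ = D + (L * Fᵀ - l * fᵀ) - Dh := by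
      rw [hDsum]; abel
    rw [h1, hC₂]
    refine (frob_sub_le _ _).trans ?_
    linarith
  obtain ⟨P, hPL, hPw, hPp⟩ := exists_leftInverse_of_posDef L w hB hw
  obtain ⟨Q, hQF, hQv, hQp⟩ := exists_leftInverse_of_posDef F v hB hv
  have hDl : frob (w * v'ᵀ) ≤ C₃ * (C₂ * δ) := by
    rw [hC₃]
    subst hp
    refine frob_le_of_frob_add_sub_le (Q := Qᵀ) hPL ?_ ?_ ?_ hPp (by rwa [frob_transpose]) hL hF
      ?_ ?_ hlowδ
    · rw [← Matrix.transpose_mul, hQF, Matrix.transpose_one]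
    · rw [← Matrix.mul_assoc, hPw, Matrix.zero_mul]
    · rw [Matrix.mul_assoc, ← Matrix.transpose_mul, hv', ← Matrix.mul_assoc, hQv,
        Matrix.zero_mul, Matrix.transpose_zero, Matrix.mul_zero]
    · exact h1
    · exact h2
  have h3 := frob_add_le (w * v'ᵀ) Dh
  rw [← hDsum] at h3
  have h4 : frob Dh ≤ C₂ * δ := by rw [hC₂]; linarith
  linarith

/-- Consistency for one sample, the matrices being already divided by `√(NT)`, `√N` and `√T`: for
every `η` there is an `ε`, uniform in the panel size, such that whenever the error is within `ε` of
being negligible and `d = β⁰ - β` attains the least squares objective up to `ε`, then `‖d‖ < η`. -/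
theorem exists_forall_norm_lt (K₁ K₂ R : ℕ) {b B c H ρ η : ℝ} (hb : 0 < b) (hB : 0 < B)
    (hc : 0 < c) (hH : 0 ≤ H) (hρ : 0 ≤ ρ) (hη : 0 < η) :
    ∃ ε : ℝ, 0 < ε ∧ ∀ (N T : ℕ) (X : Fin K₁ ⊕ Fin K₂ → Matrix (Fin N) (Fin T) ℝ)
      (L l : Matrix (Fin N) (Fin R) ℝ) (F f : Matrix (Fin T) (Fin R) ℝ)
      (e : Matrix (Fin N) (Fin T) ℝ) (w : Matrix (Fin N) (Fin K₁) ℝ)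
      (v : Matrix (Fin T) (Fin K₁) ℝ) (a : ℝ) (d : EuclideanSpace ℝ (Fin K₁ ⊕ Fin K₂)),
      (∀ k, frob (X k) ≤ H) → frob L ≤ H → frob F ≤ H →
      (∀ k, |(X k * eᵀ).trace| ≤ ε) → ‖e‖ ≤ ε →
      c * ‖d‖ ^ 2 ≤ frobSq (∑ k, d k • X k) →
      (∀ α : EuclideanSpace ℝ (Fin K₂), ‖α‖ = 1 →
        ∀ hS : ((∑ k, α k • X (Sum.inr k)) * (∑ k, α k • X (Sum.inr k))ᵀ).IsHermitian,
          b ≤ eigTailSum hS (2 * R + K₁)) →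
      (∀ j, X (Sum.inl j) = a • Matrix.vecMulVec (fun i => w i j) (fun t => v t j)) →
      (Lᵀ * annihilator w * L - B • (1 : Matrix (Fin R) (Fin R) ℝ)).PosDef →
      (Fᵀ * annihilator v * F - B • (1 : Matrix (Fin R) (Fin R) ℝ)).PosDef →
      ‖d‖ ≤ ρ →
      frobSq (∑ k, d k • X k + (L * Fᵀ - l * fᵀ) + e) ≤ frobSq e + ε →
      ‖d‖ < η := by
  obtain ⟨p, hp⟩ : ∃ p, p = Real.sqrt ((Fintype.card (Fin R) : ℝ) / B) := ⟨_, rfl⟩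
  have hp0 : 0 ≤ p := hp ▸ Real.sqrt_nonneg _
  -- Constants: `C₁` controls the nearly minimal objective, `C₂` the high-rank part, and `C₃` is
  -- the constant of `frob_le_of_frob_add_sub_le`.
  obtain ⟨h, hh⟩ : ∃ h, h = Fintype.card (Fin K₁ ⊕ Fin K₂) * H * ρ := ⟨_, rfl⟩
  obtain ⟨s, hs⟩ : ∃ s, s = Real.sqrt (Fintype.card (Fin R ⊕ Fin R)) := ⟨_, rfl⟩
  obtain ⟨C₁, hC₁⟩ : ∃ C, C = 1 + 2 * (Fintype.card (Fin K₁ ⊕ Fin K₂) * ρ) + 2 * s * (1 + h) :=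
    ⟨_, rfl⟩
  obtain ⟨C₂, hC₂⟩ : ∃ C, C = 1 + Fintype.card (Fin K₂) * H * (Real.sqrt b)⁻¹ := ⟨_, rfl⟩
  obtain ⟨C₃, hC₃⟩ : ∃ C, C = 1 + 2 * p * Real.sqrt (Fintype.card (Fin R)) * (H + p)
      + H * (2 * p ^ 2 * Real.sqrt (Fintype.card (Fin R))) * (H + p) + H * p := ⟨_, rfl⟩
  have hs0 : 0 ≤ s := hs ▸ Real.sqrt_nonneg _
  have hh0 : 0 ≤ h := by rw [hh]; positivity
  have hC₁0 : 1 ≤ C₁ := by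
    rw [hC₁, add_assoc]; exact le_add_of_nonneg_right (by positivity)
  have hC₂0 : 1 ≤ C₂ := by rw [hC₂]; exact le_add_of_nonneg_right (by positivity)
  have hC₃0 : 0 ≤ C₃ := by rw [hC₃]; positivity
  have hsc : 0 < Real.sqrt c := Real.sqrt_pos.2 hc
  obtain ⟨M, hM⟩ : ∃ M, M = C₂ + C₂ * (2 * p ^ 2) + (C₃ + 1) * C₂ / (Real.sqrt c * η) := ⟨_, rfl⟩
  have hM1 : C₂ ≤ M := by
    rw [hM, add_assoc]; exact le_add_of_nonneg_right (by positivity)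
  have hM2 : C₂ * (2 * p ^ 2) ≤ M := by
    rw [hM]
    have : 0 ≤ (C₃ + 1) * C₂ / (Real.sqrt c * η) := by positivity
    linarith
  have hM3 : (C₃ + 1) * C₂ / (Real.sqrt c * η) ≤ M := by
    rw [hM]; exact le_add_of_nonneg_left (by positivity)
  have hM0 : 0 < M := by linarith
  -- `δ` bounds `d · X + L F' - l f'`; it is so small that `M δ < 1`.
  obtain ⟨δ, hδ⟩ : ∃ δ, δ = 1 / (M + 1) := ⟨_, rfl⟩
  have hδ0 : 0 < δ := by rw [hδ]; positivity
  have hMδ : M * δ < 1 := by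
    rw [hδ, mul_one_div, div_lt_one (by positivity)]; linarith
  refine ⟨δ ^ 2 / (2 * C₁ * (1 + δ)), by positivity, ?_⟩
  obtain ⟨ε, hε⟩ : ∃ ε, ε = δ ^ 2 / (2 * C₁ * (1 + δ)) := ⟨_, rfl⟩
  rw [← hε]
  have hε0 : 0 < ε := by rw [hε]; positivity
  have hεC : ε * C₁ * (1 + δ) < δ ^ 2 := by
    have : ε * C₁ * (1 + δ) = δ ^ 2 / 2 := by
      rw [hε]; field_simp
    rw [this]; nlinarith [sq_pos_of_pos hδ0]
  intro N T X L l F f e w v a d hX hL hF hXe he hcol hhigh hlow hw hv hd hopt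
  obtain ⟨D, hD⟩ : ∃ D, D = ∑ k, d k • X k := ⟨_, rfl⟩
  obtain ⟨x, hx⟩ : ∃ x, x = frob (D + (L * Fᵀ - l * fᵀ)) := ⟨_, rfl⟩
  have hx0 : 0 ≤ x := hx ▸ frob_nonneg _
  have hxδ : x ≤ δ := by
    have hDh : frob D ≤ h := by
      rw [hD, hh]
      exact (frob_sum_smul_le hX d).trans (mul_le_mul_of_nonneg_left hd (by positivity))
    have hDe : |(D * eᵀ).trace| ≤ ε * (Fintype.card (Fin K₁ ⊕ Fin K₂) * ρ) := by
      rw [hD]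
      refine (abs_trace_sum_smul_le hXe d).trans ?_
      gcongr
    rw [← hD, mul_transpose_sub_mul_transpose] at hopt
    have h1 := frob_add_sq_le (Matrix.fromCols L l) (Matrix.fromCols F (-f)) hopt hDe he hDh
    rw [← mul_transpose_sub_mul_transpose, ← hx, ← hs] at h1
    have h2 : x ^ 2 ≤ ε * C₁ * (1 + x) := by
      refine h1.trans ?_
      rw [mul_assoc ε C₁]
      refine mul_le_mul_of_nonneg_left ?_ hε0.le
      rw [hC₁]
      refine sub_nonneg.1 ?_
      have h3 : ∀ A : ℝ, (1 + 2 * A + 2 * s * (1 + h)) * (1 + x) - (1 + 2 * A + 2 * s * (x + h))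
        = (1 + 2 * A + 2 * s * h) * x + 2 * s := fun A => by ring
      rw [h3]
      positivity
    exact le_of_sq_le_mul_one_add hδ0 h2 hεC
  have hDδ : frob D ≤ (C₃ + 1) * C₂ * δ := by
    rw [hD]
    refine frob_sum_smul_le_of_frob_add_le hb hB hp hC₂ hC₃ ?_ ?_ hX hL hF hhigh hlow hw hv
      (hD ▸ hx ▸ hxδ)
    · exact (mul_le_mul_of_nonneg_right hM1 hδ0.le).trans hMδ.le
    · have h1 := mul_le_mul_of_nonneg_right hM2 hδ0.le
      linarith
  have hcd : Real.sqrt c * ‖d‖ ≤ frob D := by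
    refine le_of_sq_le_sq ?_ (frob_nonneg D)
    rw [mul_pow, Real.sq_sqrt hc.le, frob_sq, hD]
    exact hcol
  have hlast : (C₃ + 1) * C₂ * δ < Real.sqrt c * η := by
    have h1 : (C₃ + 1) * C₂ / (Real.sqrt c * η) * δ < 1 :=
      (mul_le_mul_of_nonneg_right hM3 hδ0.le).trans_lt hMδ
    rwa [div_mul_eq_mul_div, div_lt_one (by positivity)] at h1
  exact lt_of_mul_lt_mul_left (hcd.trans_lt (hDδ.trans_lt hlast)) hsc.le

end Deterministic

/-! ### Events of probability approaching one -/

section Probability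

variable {Ω : Type*} [MeasurableSpace Ω] {μ : Measure Ω}

theorem WPA1.mono {P Q : ℕ → ℕ → Ω → Prop} (hP : WPA1 μ P)
    (h : ∀ᶠ p : ℕ × ℕ in atTop, ∀ ω, P p.1 p.2 ω → Q p.1 p.2 ω) : WPA1 μ Q := by
  refine tendsto_of_tendsto_of_tendsto_of_le_of_le' tendsto_const_nhds hP
    (Eventually.of_forall fun _ => zero_le) (h.mono fun p hp => measure_mono fun ω hω hPω => ?_)
  exact hω (hp ω hPω)

theorem WPA1.and {P Q : ℕ → ℕ → Ω → Prop} (hP : WPA1 μ P) (hQ : WPA1 μ Q) :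
    WPA1 μ (fun N T ω => P N T ω ∧ Q N T ω) := by
  have h := Tendsto.add hP hQ
  rw [add_zero] at h
  refine tendsto_of_tendsto_of_tendsto_of_le_of_le tendsto_const_nhds h (fun _ => zero_le)
    fun p => (measure_mono fun ω hω => ?_).trans (measure_union_le _ _)
  exact not_and_or.1 hω

theorem WPA1.of_ae {P : ℕ → ℕ → Ω → Prop} (h : ∀ N T, ∀ᵐ ω ∂μ, P N T ω) : WPA1 μ P := by
  have : (fun p : ℕ × ℕ => μ {ω | ¬ P p.1 p.2 ω}) = fun _ => 0 :=
    funext fun p => ae_iff.1 (h p.1 p.2)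
  rw [WPA1, this]
  exact tendsto_const_nhds

theorem WPA1.forall_finset {ι : Type*} {P : ι → ℕ → ℕ → Ω → Prop} (h : ∀ i, WPA1 μ (P i))
    (s : Finset ι) : WPA1 μ (fun N T ω => ∀ i ∈ s, P i N T ω) := by
  classical
  induction s using Finset.induction_on with
  | empty => exact WPA1.of_ae fun N T => Eventually.of_forall fun ω i hi => by simp at hi
  | insert a s _ ih =>
    refine ((h a).and ih).mono (Eventually.of_forall fun p ω hω i hi => ?_)
    rcases Finset.mem_insert.1 hi with rfl | hi
    · exact hω.1
    · exact hω.2 i hi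

theorem WPA1.forall_fintype {ι : Type*} [Fintype ι] {P : ι → ℕ → ℕ → Ω → Prop}
    (h : ∀ i, WPA1 μ (P i)) : WPA1 μ (fun N T ω => ∀ i, P i N T ω) :=
  (WPA1.forall_finset h Finset.univ).mono
    (Eventually.of_forall fun _ _ hω i => hω i (Finset.mem_univ i))

theorem Plim.wpa1_abs_sub_lt {A : ℕ → ℕ → Ω → ℝ} {a : ℝ} (h : Plim μ A a) {ε : ℝ} (hε : 0 < ε) :
    WPA1 μ (fun N T ω => |A N T ω - a| < ε) := by
  have h1 := h (ENNReal.ofReal ε) (ENNReal.ofReal_pos.2 hε)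
  refine h1.congr fun p => ?_
  congr 1
  ext ω
  simp only [Set.mem_ofPred_eq, not_lt, edist_dist, Real.dist_eq]
  exact ENNReal.ofReal_le_ofReal_iff (abs_nonneg _)

theorem plim_of_wpa1_norm_sub_lt {E : Type*} [NormedAddCommGroup E] {A : ℕ → ℕ → Ω → E} {a : E}
    (h : ∀ ε : ℝ, 0 < ε → WPA1 μ (fun N T ω => ‖a - A N T ω‖ < ε)) : Plim μ A a := by
  refine tendstoInMeasure_of_ne_top fun ε hε hε' => ?_
  refine (h ε.toReal (ENNReal.toReal_pos hε.ne' hε')).congr fun p => ?_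
  congr 1
  ext ω
  rw [Set.mem_ofPred_eq, Set.mem_ofPred_eq, not_lt, edist_comm, edist_dist, dist_eq_norm,
    ENNReal.le_ofReal_iff_toReal_le hε' (norm_nonneg _)]

end Probability

/-! ### Positive definite limits -/

section PositiveDefinite

variable {k : Type*} [Fintype k]

theorem exists_quadForm_lower_of_posDef {S : Matrix k k ℝ} (hS : S.PosDef) :
    ∃ c : ℝ, 0 < c ∧ ∀ x : EuclideanSpace ℝ k,
      c * ‖x‖ ^ 2 ≤ ∑ i, ∑ j, S i j * x i * x j := by
  obtain ⟨q, hq⟩ : ∃ q : EuclideanSpace ℝ k → ℝ, q = fun x => ∑ i, ∑ j, S i j * x i * x j :=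
    ⟨_, rfl⟩
  have hqc : Continuous q := by rw [hq]; fun_prop
  have hqpos : ∀ x, x ≠ 0 → 0 < q x := by
    intro x hx
    have h := hS.dotProduct_mulVec_pos (x := x.ofLp) (by simpa using hx)
    refine h.trans_eq ?_
    simp only [hq, dotProduct, Matrix.mulVec, Finset.mul_sum, star_trivial]
    exact Finset.sum_congr rfl fun i _ => Finset.sum_congr rfl fun j _ => by ring
  rcases (Metric.sphere (0 : EuclideanSpace ℝ k) 1).eq_empty_or_nonempty with he | hne
  · refine ⟨1, one_pos, fun x => ?_⟩
    have hx : x = 0 := by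
      by_contra hx
      have : ‖x‖⁻¹ • x ∈ Metric.sphere (0 : EuclideanSpace ℝ k) 1 := by
        simp [norm_smul, norm_ne_zero_iff.2 hx]
      rw [he] at this
      exact this
    simp [hx]
  obtain ⟨x₀, hx₀, hmin⟩ := (isCompact_sphere (0 : EuclideanSpace ℝ k) 1).exists_isMinOn hne
    hqc.continuousOn
  have hx₀0 : x₀ ≠ 0 := by
    rintro rfl
    simp at hx₀
  refine ⟨q x₀, hqpos x₀ hx₀0, fun x => ?_⟩
  rcases eq_or_ne x 0 with rfl | hx
  · simp
  have hn : ‖x‖ ≠ 0 := norm_ne_zero_iff.2 hx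
  have h1 : q x₀ ≤ q (‖x‖⁻¹ • x) := hmin (by simp [norm_smul, hn])
  have h2 : q (‖x‖⁻¹ • x) = (‖x‖⁻¹) ^ 2 * q x := by
    simp only [hq, PiLp.smul_apply, smul_eq_mul, Finset.mul_sum]
    exact Finset.sum_congr rfl fun i _ => Finset.sum_congr rfl fun j _ => by ring
  rw [h2, inv_pow, inv_mul_eq_div, le_div_iff₀ (by positivity)] at h1
  simpa only [hq] using h1

/-- The lower bound on the quadratic form of a positive definite matrix survives small
perturbations of its entries. -/
theorem exists_quadForm_lower_of_near_posDef {S : Matrix k k ℝ} (hS : S.PosDef) :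
    ∃ c ε : ℝ, 0 < c ∧ 0 < ε ∧ ∀ A : Matrix k k ℝ, (∀ i j, |A i j - S i j| < ε) →
      ∀ x : EuclideanSpace ℝ k, c * ‖x‖ ^ 2 ≤ ∑ i, ∑ j, A i j * x i * x j := by
  obtain ⟨c, hc, h⟩ := exists_quadForm_lower_of_posDef hS
  obtain ⟨K, hK⟩ : ∃ K : ℝ, K = Fintype.card k := ⟨_, rfl⟩
  refine ⟨c / 2, c / (2 * (K ^ 2 + 1)), by positivity, by positivity, fun A hA x => ?_⟩
  obtain ⟨ε, hε⟩ : ∃ ε, ε = c / (2 * (K ^ 2 + 1)) := ⟨_, rfl⟩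
  rw [← hε] at hA
  have hterm : ∀ i j, S i j * x i * x j - ε * ‖x‖ ^ 2 ≤ A i j * x i * x j := by
    intro i j
    have h1 : |(S i j - A i j) * (x i * x j)| ≤ ε * (‖x‖ * ‖x‖) := by
      rw [abs_mul, abs_mul, abs_sub_comm]
      exact mul_le_mul (hA i j).le (mul_le_mul (abs_apply_le_norm x i) (abs_apply_le_norm x j)
        (abs_nonneg _) (norm_nonneg _)) (by positivity) ((abs_nonneg _).trans (hA i j).le)
    have h2 := (le_abs_self _).trans h1
    linarith
  have hsum := Finset.sum_le_sum fun i (_ : i ∈ Finset.univ) =>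
    Finset.sum_le_sum fun j (_ : j ∈ Finset.univ) => hterm i j
  have hconst : ∑ _i : k, ∑ _j : k, ε * ‖x‖ ^ 2 = K ^ 2 * ε * ‖x‖ ^ 2 := by
    simp only [Finset.sum_const, Finset.card_univ, nsmul_eq_mul, hK]; ring
  simp only [Finset.sum_sub_distrib] at hsum
  rw [hconst] at hsum
  have hKε : K ^ 2 * ε ≤ c / 2 := by
    rw [hε, mul_div_assoc', div_le_div_iff₀ (by positivity) two_pos]
    nlinarith
  have := h x
  have := mul_le_mul_of_nonneg_right hKε (sq_nonneg ‖x‖)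
  linarith

theorem PlimPosDef.exists_wpa1_diag_le {Ω : Type*} [MeasurableSpace Ω] {μ : Measure Ω}
    {A : ℕ → ℕ → Ω → Matrix k k ℝ} (h : PlimPosDef μ A) :
    ∃ C : ℝ, 0 ≤ C ∧ WPA1 μ (fun N T ω => ∀ i, A N T ω i i ≤ C) := by
  obtain ⟨S, -, hS⟩ := h
  refine ⟨∑ i, |S i i| + 1, by positivity, ?_⟩
  refine (WPA1.forall_fintype fun i => (hS i i).wpa1_abs_sub_lt one_pos).mono
    (Eventually.of_forall fun p ω hω i => ?_)
  have h1 : A p.1 p.2 ω i i - S i i < 1 := (abs_lt.1 (hω i)).2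
  have h2 := le_abs_self (S i i)
  have h3 : |S i i| ≤ ∑ i, |S i i| :=
    Finset.single_le_sum (f := fun i => |S i i|) (fun i _ => abs_nonneg _) (Finset.mem_univ i)
  linarith

theorem PlimPosDef.exists_wpa1_quadForm_lower {Ω : Type*} [MeasurableSpace Ω] {μ : Measure Ω}
    {A : ℕ → ℕ → Ω → Matrix k k ℝ} (h : PlimPosDef μ A) :
    ∃ c : ℝ, 0 < c ∧ WPA1 μ (fun N T ω => ∀ x : EuclideanSpace ℝ k,
      c * ‖x‖ ^ 2 ≤ ∑ i, ∑ j, A N T ω i j * x i * x j) := by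
  obtain ⟨S, hS, hlim⟩ := h
  obtain ⟨c, ε, hc, hε, hA⟩ := exists_quadForm_lower_of_near_posDef hS
  exact ⟨c, hc, (WPA1.forall_fintype fun i => WPA1.forall_fintype fun j =>
    (hlim i j).wpa1_abs_sub_lt hε).mono (Eventually.of_forall fun p ω hω => hA _ hω)⟩

end PositiveDefinite

/-! ### The least squares objective -/

namespace Panel

variable {Ω : Type*} {K₁ K₂ R : ℕ} (P : Panel Ω K₁ K₂ R)

/-- Since the true loadings and factors are admissible, the profile objective at the estimate is
at most the mean square of the errors; it is attained up to any `ε` by some factor structure. -/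
theorem IsLSEstimate.exists_objective_lt {𝔹 : Set (EuclideanSpace ℝ (Fin K₁ ⊕ Fin K₂))} {N T : ℕ}
    {ω : Ω} {β : EuclideanSpace ℝ (Fin K₁ ⊕ Fin K₂)} (h : P.IsLSEstimate 𝔹 N T ω β)
    (hmem : P.beta0 ∈ 𝔹) {ε : ℝ} (hε : 0 < ε) :
    ∃ l f, P.objective N T ω β l f < ((N : ℝ) * T)⁻¹ * frobSq (P.e N T ω) + ε := by
  have h0 : P.objective N T ω P.beta0 (P.lam0 N T ω) (P.f0 N T ω) =
      ((N : ℝ) * T)⁻¹ * frobSq (P.e N T ω) := by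
    rw [objective, Y]
    congr 2
    abel
  have h1 : P.profile N T ω P.beta0 ≤ ((N : ℝ) * T)⁻¹ * frobSq (P.e N T ω) := by
    rw [← h0]
    exact ciInf_le (f := fun q : Matrix (Fin N) (Fin R) ℝ × Matrix (Fin T) (Fin R) ℝ =>
      P.objective N T ω P.beta0 q.1 q.2) ⟨0, by
        rintro _ ⟨q, rfl⟩
        exact mul_nonneg (by positivity) (frobSq_nonneg _)⟩ (P.lam0 N T ω, P.f0 N T ω)
  obtain ⟨q, hq⟩ := exists_lt_of_ciInf_lt
    (((h.2 _ hmem).trans h1).trans_lt (lt_add_of_pos_right _ hε))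
  exact ⟨q.1, q.2, hq⟩

theorem objective_eq (N T : ℕ) (ω : Ω) (β : EuclideanSpace ℝ (Fin K₁ ⊕ Fin K₂))
    (l : Matrix (Fin N) (Fin R) ℝ) (f : Matrix (Fin T) (Fin R) ℝ) :
    P.objective N T ω β l f = frobSq (∑ k, (P.beta0 - β) k •
        ((Real.sqrt ((N : ℝ) * T))⁻¹ • P.X k N T ω)
      + (((Real.sqrt N)⁻¹ • P.lam0 N T ω) * ((Real.sqrt T)⁻¹ • P.f0 N T ω)ᵀ
        - ((Real.sqrt ((N : ℝ) * T))⁻¹ • l) * fᵀ)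
      + (Real.sqrt ((N : ℝ) * T))⁻¹ • P.e N T ω) := by
  have hN : (Real.sqrt ((N : ℝ) * T))⁻¹ = (Real.sqrt N)⁻¹ * (Real.sqrt T)⁻¹ := by
    rw [Real.sqrt_mul (Nat.cast_nonneg N), mul_inv]
  have hs : ((N : ℝ) * T)⁻¹ = (Real.sqrt ((N : ℝ) * T))⁻¹ ^ 2 := by
    rw [inv_pow, Real.sq_sqrt (by positivity)]
  rw [objective, hs, ← frobSq_smul]
  congr 1
  have hd : P.dotX P.beta0 N T ω - P.dotX β N T ω = ∑ k, (P.beta0 - β) k • P.X k N T ω := by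
    simp only [dotX, ← Finset.sum_sub_distrib, ← sub_smul, PiLp.sub_apply]
  have hY : P.Y N T ω - P.dotX β N T ω - l * fᵀ = ∑ k, (P.beta0 - β) k • P.X k N T ω
      + (P.lam0 N T ω * (P.f0 N T ω)ᵀ - l * fᵀ) + P.e N T ω := by
    rw [← hd, Y]; abel
  rw [hY, smul_add, smul_add, smul_sub, Finset.smul_sum, Matrix.transpose_smul,
    Matrix.smul_mul _ (P.lam0 N T ω), Matrix.mul_smul, smul_smul, ← hN, Matrix.smul_mul]
  simp only [smul_smul, mul_comm]

theorem frobSq_sum_smul_eq (N T : ℕ) (ω : Ω) (d : EuclideanSpace ℝ (Fin K₁ ⊕ Fin K₂)) :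
    frobSq (∑ k, d k • ((Real.sqrt ((N : ℝ) * T))⁻¹ • P.X k N T ω)) =
      ∑ k, ∑ l, (((N : ℝ) * T)⁻¹ * ∑ i, ∑ t, P.X k N T ω i t * P.X l N T ω i t) * d k * d l := by
  have hs : ((N : ℝ) * T)⁻¹ = (Real.sqrt ((N : ℝ) * T))⁻¹ * (Real.sqrt ((N : ℝ) * T))⁻¹ := by
    rw [← mul_inv, Real.mul_self_sqrt (by positivity)]
  simp only [← trace_mul_transpose_eq_sum]
  rw [frobSq, Matrix.transpose_sum, Matrix.sum_mul, Matrix.trace_sum]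
  refine Finset.sum_congr rfl fun k _ => ?_
  rw [Matrix.mul_sum, Matrix.trace_sum]
  refine Finset.sum_congr rfl fun l _ => ?_
  simp only [Matrix.transpose_smul, Matrix.smul_mul, Matrix.mul_smul, Matrix.trace_smul,
    smul_eq_mul, hs]
  ring

end Panel

theorem frob_inv_sqrt_smul_le {N R : ℕ} {L : Matrix (Fin N) (Fin R) ℝ} {C : ℝ}
    (h : ∀ i, ((N : ℝ)⁻¹ • (Lᵀ * L)) i i ≤ C) :
    frob ((Real.sqrt N)⁻¹ • L) ≤ Real.sqrt (R * C) := by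
  refine Real.sqrt_le_sqrt ?_
  rw [frobSq_smul, inv_pow, Real.sq_sqrt (Nat.cast_nonneg N), frobSq, Matrix.trace_mul_comm,
    ← smul_eq_mul, ← Matrix.trace_smul]
  calc ((N : ℝ)⁻¹ • (Lᵀ * L)).trace ≤ ∑ _i : Fin R, C := Finset.sum_le_sum fun i _ => h i
    _ = R * C := by simp

theorem inv_sqrt_smul_gram {N R : ℕ} (L : Matrix (Fin N) (Fin R) ℝ)
    (M : Matrix (Fin N) (Fin N) ℝ) :
    ((Real.sqrt N)⁻¹ • L)ᵀ * M * ((Real.sqrt N)⁻¹ • L) = (N : ℝ)⁻¹ • (Lᵀ * M * L) := by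
  rw [Matrix.transpose_smul, Matrix.smul_mul, Matrix.smul_mul, Matrix.mul_smul, smul_smul,
    ← mul_inv, Real.mul_self_sqrt (Nat.cast_nonneg N)]

/-! ### Consistency of the least squares estimator -/

theorem eigTailSum_congr {n : Type*} [Fintype n] [DecidableEq n] {S S' : Matrix n n ℝ}
    (h : S = S') (hS : S.IsHermitian) (hS' : S'.IsHermitian) (k : ℕ) :
    eigTailSum hS k = eigTailSum hS' k := by
  subst h; rfl

end InteractiveFE

end

theorem mainTheorem2 {Ω : Type*} [MeasurableSpace Ω] (μ : Measure Ω) [IsProbabilityMeasure μ]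
    {K₁ K₂ R : ℕ} (P : InteractiveFE.Panel Ω K₁ K₂ R)
    (hfactors : P.StrongFactors μ)
    (hexog : P.WeakExogeneity μ)
    (herror : P.SmallErrorNorm μ)
    (hcollinear : P.NonCollinear μ)
    (hhigh : P.HighRankCondition μ)
    (hlow : P.LowRankCondition μ)
    (𝔹 : Set (EuclideanSpace ℝ (Fin K₁ ⊕ Fin K₂)))
    (hcompact : IsCompact 𝔹)
    (hmem : P.beta0 ∈ 𝔹)
    (betaHat : ℕ → ℕ → Ω → EuclideanSpace ℝ (Fin K₁ ⊕ Fin K₂))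
    (hbetaHat : ∀ N T : ℕ, ∀ᵐ ω ∂μ, P.IsLSEstimate 𝔹 N T ω (betaHat N T ω)) :
    InteractiveFE.Plim μ betaHat P.beta0 := by
  open InteractiveFE in
  obtain ⟨ρ, hρ, hbound⟩ := hcompact.isBounded.exists_pos_norm_le
  obtain ⟨c, hc, hquad⟩ := hcollinear.exists_wpa1_quadForm_lower
  obtain ⟨CX, hCX, hdiagX⟩ := hcollinear.exists_wpa1_diag_le
  obtain ⟨CL, hCL, hdiagL⟩ := hfactors.1.exists_wpa1_diag_le
  obtain ⟨CF, hCF, hdiagF⟩ := hfactors.2.exists_wpa1_diag_le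
  obtain ⟨b, hb, hhigh⟩ := hhigh
  obtain ⟨w, v, B, hB, hlow⟩ := hlow
  obtain ⟨H, hH⟩ : ∃ H, H = Real.sqrt CX + Real.sqrt (R * CL) + Real.sqrt (R * CF) := ⟨_, rfl⟩
  have hHX : Real.sqrt CX ≤ H := by
    rw [hH, add_assoc]; exact le_add_of_nonneg_right (by positivity)
  have hHL : Real.sqrt (R * CL) ≤ H := by
    rw [hH, add_right_comm]; exact le_add_of_nonneg_left (by positivity)
  have hHF : Real.sqrt (R * CF) ≤ H := by
    rw [hH]; exact le_add_of_nonneg_left (by positivity)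
  refine plim_of_wpa1_norm_sub_lt fun η hη => ?_
  obtain ⟨ε, hε, hmain⟩ := exists_forall_norm_lt K₁ K₂ R hb hB hc
    ((Real.sqrt_nonneg _).trans hHX) (show (0 : ℝ) ≤ 2 * ρ by positivity) hη
  have hex := WPA1.forall_fintype fun k => (hexog k).wpa1_abs_sub_lt hε
  have her := Plim.wpa1_abs_sub_lt herror hε
  -- It suffices to treat a single outcome in the intersection of all the events.
  refine (((hquad.and hdiagX).and (hdiagL.and hdiagF)).and ((hhigh.and hlow).and
    ((hex.and her).and (WPA1.of_ae hbetaHat)))).mono (Filter.Eventually.of_forall ?_)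
  rintro ⟨N, T⟩ ω ⟨⟨⟨hq, hdX⟩, hdL, hdF⟩, ⟨hhi, hlo, hw, hv⟩, ⟨hxe, hen⟩, hest⟩
  obtain ⟨l, f, hobj⟩ := hest.exists_objective_lt P hmem hε
  obtain ⟨a, ha⟩ : ∃ a, a = (Real.sqrt ((N : ℝ) * T))⁻¹ := ⟨_, rfl⟩
  have ha0 : 0 ≤ a := by rw [ha]; positivity
  have ha2 : a * a = ((N : ℝ) * T)⁻¹ := by
    rw [ha, ← mul_inv, Real.mul_self_sqrt (by positivity)]
  rw [P.objective_eq, ← ha] at hobj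
  refine hmain N T (fun k => a • P.X k N T ω) ((Real.sqrt N)⁻¹ • P.lam0 N T ω) (a • l)
    ((Real.sqrt T)⁻¹ • P.f0 N T ω) f (a • P.e N T ω) (w N T ω) (v N T ω) a
    (P.beta0 - betaHat N T ω) ?_ ((frob_inv_sqrt_smul_le hdL).trans hHL)
    ((frob_inv_sqrt_smul_le hdF).trans hHF) ?_ ?_ ?_ ?_ ?_ ?_ ?_ ?_ ?_
  · intro k
    refine le_trans (Real.sqrt_le_sqrt ?_) hHX
    rw [frobSq_smul, frobSq, trace_mul_transpose_eq_sum, sq, ha2]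
    exact hdX k
  · intro k
    have h := hxe k
    rw [sub_zero, ← ha2] at h
    rw [Matrix.transpose_smul, Matrix.smul_mul, Matrix.mul_smul, smul_smul, Matrix.trace_smul,
      smul_eq_mul]
    exact h.le
  · have h := hen
    rw [sub_zero, div_eq_inv_mul, ← ha, abs_of_nonneg (by positivity)] at h
    rw [norm_smul, Real.norm_of_nonneg ha0]
    exact h.le
  · rw [ha, P.frobSq_sum_smul_eq]
    exact hq _
  · intro α hα hS
    refine (hhi α hα).trans_eq (eigTailSum_congr ?_ _ hS _)
    simp only [smul_comm _ a, ← Finset.smul_sum]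
    rw [Matrix.transpose_smul, Matrix.smul_mul, Matrix.mul_smul, smul_smul, ha2]
    rfl
  · intro j
    rw [← (hlo j).2]
  · rw [inv_sqrt_smul_gram]
    exact hw
  · rw [inv_sqrt_smul_gram]
    exact hv
  · calc ‖P.beta0 - betaHat N T ω‖ ≤ ‖P.beta0‖ + ‖betaHat N T ω‖ := norm_sub_le _ _
      _ ≤ 2 * ρ := by linarith [hbound _ hmem, hbound _ hest.1]
  · rw [frobSq_smul, sq, ha2]
    exact hobj.le
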